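/- **Setup.** Put $s=1+\sqrt2$ and, for $i\ge 0$, $\beta_i=1+s^{i-1}$. Define recursively $$\mu_i = 2\sum_{\ell=0}^{i-1}\alpha_\ell+\sum_{\ell=0}^{i-2}2(2^{i-\ell-1}-1)\beta_\ell+2,$$ where $\alpha_i$ is the unique root larger than $1$ of $2(x-1)^2+(\mu_i-1)(x-1)-(\beta_{i+1}-1)(\mu_i-1)$. For $n\ge1$ let $\nu(n)$ be the $2$-adic valuation of $n$. For $i\ge 0$ let $z(i)=\lfloor\log_2(i+1)\rfloor$ and let $p(i)$ be the number of ones in the binary expansion of $i+1$. Square brackets denote concatenation of vectors. Let $\pi^{(\ell)}=[\beta_{\nu(1)},\dots,\beta_{\nu(2^\ell-1)}]\in\mathbb R^{2^\ell-1}$ and $$\mathfrak h^{(k)}=[\alpha_0,\pi^{(0)},\dots,\alpha_{k-1},\pi^{(k-1)},\ \mu_k,\ \pi^{(k-1)},\alpha_{k-1},\dots,\pi^{(0)},\alpha_0]\in\mathbb R^{2^{k+1}-1}.$$ Let $\sigma^{(1)}=\emptyset$ and $\sigma^{(k)}=\tfrac12 s^{-2(k-1)}[\pi^{(k-2)},\beta_k,2s^{2(k-1)}\sigma^{(k-1)}]$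 for $k\ge2$. Let $\rho_0=[0,1]$ and $\rho_k=[s^{k-2},\ s^{2k-1}\sigma^{(k)}-\tfrac{1}{2s}\pi^{(k-1)},\ 0,\ \pi^{(k)},\ 1]$ for $k\ge1$. Let $w_0=[1]$ and $w_k=[\pi^{(k-1)}/\sqrt{\mu_k-1},\ \beta_k/\sqrt{\mu_k-1},\ w_{k-1}]$ for $k\ge 1$. For $k\ge1$ let $$\phi^{(k)}=[0_{2^k-1},\ \sqrt{\mu_k-1},\ w_k]\in\mathbb R^{2^{k+1}}.$$ **The certificate.** For $k\ge1$, $\lambda^{(k)}$ is the real matrix with rows and columns indexed by $\{\star,0,\dots,2^{k+1}-1\}$ such that row $\star$, column $\star$ and row $2^{k+1}-1$ are zero and, for $0\le i\le 2^{k+1}-2$ and $\ell=\nu(i+1)$, $\lambda^{(k)}_{i,j}=v_{j-i+\lfloor 2^{\ell-1}\rfloor}$ for $j\in[i-\lfloor 2^{\ell-1}\rfloor,\,i+2^\ell]\setminus\{i\}$ and $\lambda^{(k)}_{i,j}=0$ for the other $j$. Here the vector $v=v^{(k,i)}$, indexed from $0$, is: 1. if $i+1<2^k$ is not a power of two: $\dfrac{\mu_{z(i)+1}-1}{s^{2(z(i)-p(i))+3}}\,\rho_\ell$;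 2. if $i+1>2^k$ and $2^{k+1}-1-i$ is not a power of two: $\dfrac{s^{2(p(i)+z'-k)-1}}{\mu_{z'+1}-1}\,\rho_\ell$ with $z'=z(2^{k+1}-2-i)$; 3. if $i+1=2^\ell$ with $\ell<k$: $[0,2]$ if $\ell=0$, and otherwise $\left[\tfrac12(\mu_\ell-1)s^{-(\ell-1)}-1,\ (\mu_\ell-1)\sigma^{(\ell)},\ 0,\ \tfrac{\mu_{\ell+1}-1}{2s^{2\ell}}\pi^{(\ell)},\ \tfrac{\mu_{\ell+1}-1}{2s^{2\ell}}\right]$; 4. if $i+1=2^k$: $\left[\tfrac12(\mu_k-1)s^{-(k-1)}-1,\ (\mu_k-1)\sigma^{(k)},\ 0,\ w_k/\sqrt{\mu_k-1}\right]$; 5. if $i=2^{k+1}-2^\ell-1$ with $\ell<k$: $[0,\tfrac12]$ if $\ell=0$, and otherwise $\left[\tfrac{s^{\ell-1}}{\mu_{\ell+1}-1},\ \tfrac{1}{\mu_{\ell+1}-1}\left(s^{2\ell}\sigma^{(\ell)}-\tfrac12\pi^{(\ell-1)}\right),\ 0,\ \left(\tfrac1{\sqrt{\mu_\ell-1}}-\tfrac1{\sqrt{\mu_{\ell+1}-1}}\right)w_\ell\right]$.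 **The matrix $M$.** Let $t\ge 1$, $L>0$, $h\in\mathbb R^t$, and let $e_1,\dots,e_{t+2}$ be the standard basis of $\mathbb R^{t+2}$. Put $\mathbf g_\star=\mathbf x_\star=0$, $\mathbf g_i=e_{i+2}$, $\mathbf x_i=e_1-\frac1L\sum_{j<i}h_j\mathbf g_j$ for $0\le i\le t$, and $x\odot y=\frac12(xy^{\mathsf T}+yx^{\mathsf T})$. For a real matrix $\lambda$ indexed by $\{\star,0,\dots,t\}$ and $v\in\mathbb R$ let $$Z=v\,(\mathbf x_0\odot\mathbf x_0)+\sum_{i\ne j}\lambda_{i,j}\Big(\mathbf g_j\odot(\mathbf x_i-\mathbf x_j)+\tfrac1{2L}(\mathbf g_i-\mathbf g_j)\odot(\mathbf g_i-\mathbf g_j)\Big),$$ with the sum over $i,j\in\{\star,0,\dots,t\}$, and let $M(\lambda,h)=M_L(\lambda,h)$ be the block of $Z$ obtained by deleting its first row and column; it does not depend on $v$. **Theorem.** For all $k\ge1$ and $L>0$, $$M_L(\lambda^{(k)},\mathfrak h^{(k)})=\frac{1}{2L}\,\phi^{(k)}(\phi^{(k)})^{\mathsf T},$$ and this matrix has nonnegative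 entries and rank one. In particular, with the normalization $L=1$, $M(\lambda^{(k)},\mathfrak h^{(k)})=\tfrac12\phi^{(k)}(\phi^{(k)})^{\mathsf T}$. -/

import Mathlib

namespace LongSteps

noncomputable section

/-! ### The building block patterns -/

/-- `β_i = 1 + (1+√2)^(i-1)`. -/
def beta (i : ℕ) : ℝ := 1 + (1 + √2) ^ ((i : ℤ) - 1)

/-- The quadratic `2(x-1)² + (m-1)(x-1) - (b-1)(m-1)`; the polynomial `q_i` of the construction
is the case `m = μ_i`, `b = β_{i+1}`. -/
def quad (m b x : ℝ) : ℝ := 2 * (x - 1) ^ 2 + (m - 1) * (x - 1) - (b - 1) * (m - 1)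

/-- The expression `2 ∑_{ℓ<i} a_ℓ + ∑_{ℓ<i-1} 2 (2^(i-ℓ-1) - 1) β_ℓ + 2`, which defines `μ_i` from
the values `a_ℓ = α_ℓ`, `ℓ < i`. -/
def muOf (i : ℕ) (a : Fin i → ℝ) : ℝ :=
  2 * ∑ l : Fin i, a l
    + ∑ l ∈ Finset.range (i - 1), 2 * ((2 : ℝ) ^ (i - l - 1) - 1) * beta l + 2

/-- `α_i`: the root larger than `1` of `q_i` (by recursion, as `μ_i` depends only on `α_ℓ` with
`ℓ < i`). It exists and is unique, see `alpha_spec` and `alpha_unique`. -/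
def alpha (i : ℕ) : ℝ :=
  Classical.epsilon fun x : ℝ =>
    1 < x ∧ quad (muOf i fun l : Fin i => alpha l.1) (beta (i + 1)) x = 0
termination_by i
decreasing_by exact l.2

/-- `μ_i`. -/
def mu (i : ℕ) : ℝ := muOf i fun l : Fin i => alpha l.1

theorem beta_gt_one (i : ℕ) : 1 < beta i := by
  unfold beta
  have : (0 : ℝ) < (1 + √2) ^ ((i : ℤ) - 1) := by positivity
  linarith

theorem quad_exists {m b : ℝ} (hm : 1 < m) (hb : 1 < b) : ∃ x : ℝ, 1 < x ∧ quad m b x = 0 := by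
  have hp : 0 < 8 * (b - 1) * (m - 1) :=
    mul_pos (mul_pos (by norm_num) (sub_pos.2 hb)) (sub_pos.2 hm)
  have hs : m - 1 < √((m - 1) ^ 2 + 8 * (b - 1) * (m - 1)) :=
    Real.lt_sqrt_of_sq_lt (by linarith)
  have hq : √((m - 1) ^ 2 + 8 * (b - 1) * (m - 1)) ^ 2 = (m - 1) ^ 2 + 8 * (b - 1) * (m - 1) :=
    Real.sq_sqrt (by positivity)
  refine ⟨1 + (√((m - 1) ^ 2 + 8 * (b - 1) * (m - 1)) - (m - 1)) / 4, by linarith, ?_⟩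
  unfold quad
  linear_combination hq / 8

theorem quad_unique {m b x y : ℝ} (hm : 1 < m) (hx : 1 < x) (hy : 1 < y)
    (hqx : quad m b x = 0) (hqy : quad m b y = 0) : x = y := by
  unfold quad at hqx hqy
  have h : (x - y) * (2 * (x - 1 + (y - 1)) + (m - 1)) = 0 := by
    linear_combination hqx - hqy
  rcases mul_eq_zero.1 h with h | h <;> linarith

theorem muOf_gt_one (i : ℕ) (a : Fin i → ℝ) (ha : ∀ l, 1 < a l) : 1 < muOf i a := by
  unfold muOf
  have h1 : 0 ≤ ∑ l : Fin i, a l := Finset.sum_nonneg fun l _ => by linarith [ha l]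
  have h2 : 0 ≤ ∑ l ∈ Finset.range (i - 1), 2 * ((2 : ℝ) ^ (i - l - 1) - 1) * beta l := by
    refine Finset.sum_nonneg fun l _ => ?_
    have h3 : (1 : ℝ) ≤ 2 ^ (i - l - 1) := one_le_pow₀ (by norm_num)
    have h4 := beta_gt_one l
    exact mul_nonneg (by linarith) (by linarith)
  linarith

/-- `α_i` is larger than `1` and is a root of `q_i`. -/
theorem alpha_spec (i : ℕ) : 1 < alpha i ∧ quad (mu i) (beta (i + 1)) (alpha i) = 0 := by
  induction i using Nat.strong_induction_on with
  | _ i ih =>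
    have h := Classical.epsilon_spec (quad_exists
      (muOf_gt_one i (fun l : Fin i => alpha l.1) fun l => (ih l.1 l.2).1) (beta_gt_one (i + 1)))
    rw [← alpha] at h
    exact h

/-- `α_i` is the only root of `q_i` larger than `1`. -/
theorem alpha_unique (i : ℕ) (x : ℝ) (hx : 1 < x) (hq : quad (mu i) (beta (i + 1)) x = 0) :
    x = alpha i :=
  quad_unique (muOf_gt_one i _ fun l => (alpha_spec l.1).1) hx (alpha_spec i).1 hq (alpha_spec i).2

/-- The `2`-adic valuation (only used at positive integers). -/
def nu (n : ℕ) : ℕ := padicValNat 2 n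

/-- The vector `π^(ℓ) = [β_{ν(1)}, …, β_{ν(2^ℓ - 1)}]`. -/
def piVec (l : ℕ) : List ℝ := (List.range (2 ^ l - 1)).map fun i => beta (nu (i + 1))

/-- The pattern `𝔥^(k) = [α_0, π^(0), …, α_{k-1}, π^(k-1), μ_k, π^(k-1), α_{k-1}, …, π^(0), α_0]`,
as a list of length `2^(k+1) - 1`. -/
def patternList (k : ℕ) : List ℝ :=
  (List.range k).flatMap (fun l => [alpha l] ++ piVec l) ++ [mu k] ++
    (List.range k).reverse.flatMap (fun l => piVec l ++ [alpha l])

/-- The pattern `𝔥^(k) ∈ ℝ^(2^(k+1) - 1)`. -/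
def pattern (k : ℕ) : Fin (2 ^ (k + 1) - 1) → ℝ := fun i => (patternList k).getD i.1 0

/-! ### The certificates -/

/-- Scalar multiple of a vector. -/
def scale (c : ℝ) (v : List ℝ) : List ℝ := v.map fun x => c * x

/-- Difference of two vectors of the same length. -/
def diff (u v : List ℝ) : List ℝ := List.zipWith (fun x y => x - y) u v

/-- `z(i) = ⌊log₂ (i+1)⌋`. -/
def z (i : ℕ) : ℕ := Nat.log 2 (i + 1)

/-- `p(i)`: the number of ones in the binary expansion of `i+1`. -/
def p (i : ℕ) : ℕ := (Nat.digits 2 (i + 1)).count 1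

/-- `σ^(k)`, of length `2^(k-1) - 1`, for `k ≥ 1` (the value at `0` is never used). -/
def sigma : ℕ → List ℝ
  | 0 => []
  | 1 => []
  | k + 2 =>
    scale (1 / 2 * (1 + √2) ^ (-2 * ((k : ℤ) + 1)))
      (piVec k ++ [beta (k + 2)] ++ scale (2 * (1 + √2) ^ (2 * ((k : ℤ) + 1))) (sigma (k + 1)))

/-- `ρ_k`, of length `⌊2^(k-1)⌋ + 1 + 2^k`. -/
def rho : ℕ → List ℝ
  | 0 => [0, 1]
  | k + 1 =>
    [(1 + √2) ^ ((k : ℤ) - 1)] ++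
      diff (scale ((1 + √2) ^ (2 * (k : ℤ) + 1)) (sigma (k + 1)))
        (scale (1 / (2 * (1 + √2))) (piVec k)) ++
      [0] ++ piVec (k + 1) ++ [1]

/-- `w_k`, of length `2^k`. -/
def w : ℕ → List ℝ
  | 0 => [1]
  | k + 1 =>
    scale (1 / √(mu (k + 1) - 1)) (piVec k) ++ [beta (k + 1) / √(mu (k + 1) - 1)] ++ w k

/-- The vector `v` with `λ^(k)_i ∼ v`, for `0 ≤ i ≤ 2^(k+1) - 2`; with `ℓ = ν(i+1)` it has length
`⌊2^(ℓ-1)⌋ + 1 + 2^ℓ`. Note that `i + 1` is a power of two iff `i + 1 = 2^ℓ`, and that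
`2^(k+1) - 1 - i` is a power of two iff `i + 1 + 2^ℓ = 2^(k+1)`. -/
def rowVec (k i : ℕ) : List ℝ :=
  let l := nu (i + 1)
  if i + 1 < 2 ^ k then
    if i + 1 = 2 ^ l then
      if l = 0 then [0, 2]
      else
        [1 / 2 * (mu l - 1) * (1 + √2) ^ (-((l : ℤ) - 1)) - 1] ++ scale (mu l - 1) (sigma l) ++
          [0] ++ scale ((mu (l + 1) - 1) / (2 * (1 + √2) ^ (2 * l))) (piVec l) ++
          [(mu (l + 1) - 1) / (2 * (1 + √2) ^ (2 * l))]
    else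
      scale ((mu (z i + 1) - 1) / (1 + √2) ^ (2 * ((z i : ℤ) - (p i : ℤ)) + 3)) (rho l)
  else if i + 1 = 2 ^ k then
    [1 / 2 * (mu k - 1) * (1 + √2) ^ (-((k : ℤ) - 1)) - 1] ++ scale (mu k - 1) (sigma k) ++
      [0] ++ scale (1 / √(mu k - 1)) (w k)
  else
    if i + 1 + 2 ^ l = 2 ^ (k + 1) then
      if l = 0 then [0, 1 / 2]
      else
        [(1 + √2) ^ ((l : ℤ) - 1) / (mu (l + 1) - 1)] ++
          scale (1 / (mu (l + 1) - 1))
            (diff (scale ((1 + √2) ^ (2 * l)) (sigma l)) (scale (1 / 2) (piVec (l - 1)))) ++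
          [0] ++ scale (1 / √(mu l - 1) - 1 / √(mu (l + 1) - 1)) (w l)
    else
      scale ((1 + √2) ^ (2 * ((p i : ℤ) + (z (2 ^ (k + 1) - 2 - i) : ℤ) - (k : ℤ)) - 1) /
        (mu (z (2 ^ (k + 1) - 2 - i) + 1) - 1)) (rho l)

/-- The entry `λ^(k)_{i,j}` for `i, j` in `{0, …, 2^(k+1) - 1}`. The last row is zero; in any other
row `i`, with `ℓ = ν(i+1)`, the entry is `v_{j-i+⌊2^(ℓ-1)⌋}` for `v = rowVec k i` if `j ≠ i` and this
index is in the range of `v`, and `0` otherwise. -/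
def entry (k i j : ℕ) : ℝ :=
  if i = 2 ^ (k + 1) - 1 ∨ i = j ∨ j + 2 ^ nu (i + 1) / 2 < i then 0
  else (rowVec k i).getD (j + 2 ^ nu (i + 1) / 2 - i) 0

/-- The certificate `λ^(k)`, with rows and columns indexed by `{⋆, 0, …, 2^(k+1) - 1}`; the index
`⋆` is `none`. -/
def certificate (k : ℕ) :
    Matrix (Option (Fin (2 ^ (k + 1) - 1 + 1))) (Option (Fin (2 ^ (k + 1) - 1 + 1))) ℝ :=
  fun a b => match a, b with
    | some i, some j => entry k i.1 j.1
    | _, _ => 0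

/-- `φ^(k) = [0_{2^k - 1}, √(μ_k - 1), w_k] ∈ ℝ^(2^(k+1))`, for `k ≥ 1`. -/
def phi (k : ℕ) : Fin (2 ^ (k + 1) - 1 + 1) → ℝ := fun i =>
  (List.replicate (2 ^ k - 1) 0 ++ [√(mu k - 1)] ++ w k).getD i.1 0

/-! ### The performance estimation matrices

The index set `I_t^⋆ = {⋆, 0, …, t}` is `Option (Fin (t+1))`, with `⋆ = none`; the coordinates of
`ℝ^(t+2)` are `Fin (t+2)`, the first one for `x_0` and the one with number `i + 1` (counting
from `0`) for `g_i`. -/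

/-- The vectors `𝐠_i`, with `𝐠_⋆ = 0`. -/
def gVec (t : ℕ) : Option (Fin (t + 1)) → Fin (t + 2) → ℝ
  | none => 0
  | some i => Pi.single i.succ 1

/-- The vectors `𝐱_i = 𝐱_0 - L⁻¹ ∑_{j<i} h_j 𝐠_j`, with `𝐱_⋆ = 0`. -/
def xVec (t : ℕ) (L : ℝ) (h : Fin t → ℝ) : Option (Fin (t + 1)) → Fin (t + 2) → ℝ
  | none => 0
  | some i => Pi.single 0 1 -
      (1 / L) • ∑ j : Fin t, if j.1 < i.1 then h j • gVec t (some j.castSucc) else 0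

/-- The symmetric outer product `x ⊙ y = (x yᵀ + y xᵀ) / 2`. -/
def symOuter {n : ℕ} (x y : Fin n → ℝ) : Matrix (Fin n) (Fin n) ℝ :=
  (1 / 2 : ℝ) • (Matrix.vecMulVec x y + Matrix.vecMulVec y x)

/-- `A_{i,j}(h) = 𝐠_j ⊙ (𝐱_i - 𝐱_j)`. -/
def matA (t : ℕ) (L : ℝ) (h : Fin t → ℝ) (i j : Option (Fin (t + 1))) :
    Matrix (Fin (t + 2)) (Fin (t + 2)) ℝ :=
  symOuter (gVec t j) (xVec t L h i - xVec t L h j)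

/-- `B_{i,j}(h) = (𝐱_i - 𝐱_j) ⊙ (𝐱_i - 𝐱_j)`. -/
def matB (t : ℕ) (L : ℝ) (h : Fin t → ℝ) (i j : Option (Fin (t + 1))) :
    Matrix (Fin (t + 2)) (Fin (t + 2)) ℝ :=
  symOuter (xVec t L h i - xVec t L h j) (xVec t L h i - xVec t L h j)

/-- `C_{i,j} = (𝐠_i - 𝐠_j) ⊙ (𝐠_i - 𝐠_j)`. -/
def matC (t : ℕ) (i j : Option (Fin (t + 1))) : Matrix (Fin (t + 2)) (Fin (t + 2)) ℝ :=
  symOuter (gVec t i - gVec t j) (gVec t i - gVec t j)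

/-- `Z(λ, v, h) = v B_{0,⋆} + ∑_{i ≠ j} λ_{i,j} (A_{i,j}(h) + C_{i,j} / (2L))`. -/
def matZ (t : ℕ) (L : ℝ) (lam : Matrix (Option (Fin (t + 1))) (Option (Fin (t + 1))) ℝ) (v : ℝ)
    (h : Fin t → ℝ) : Matrix (Fin (t + 2)) (Fin (t + 2)) ℝ :=
  v • matB t L h (some 0) none +
    ∑ i, ∑ j, if i ≠ j then lam i j • (matA t L h i j + (1 / (2 * L)) • matC t i j) else 0

/-- `M(λ, h)`: the lower right `(t+1) × (t+1)` block of `Z(λ, v, h)`. It does not depend on `v`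
(see `matM_eq`), which is set to `0` here. -/
def matM (t : ℕ) (L : ℝ) (lam : Matrix (Option (Fin (t + 1))) (Option (Fin (t + 1))) ℝ)
    (h : Fin t → ℝ) : Matrix (Fin (t + 1)) (Fin (t + 1)) ℝ :=
  (matZ t L lam 0 h).submatrix Fin.succ Fin.succ

theorem matM_eq (t : ℕ) (L : ℝ) (lam : Matrix (Option (Fin (t + 1))) (Option (Fin (t + 1))) ℝ)
    (v : ℝ) (h : Fin t → ℝ) :
    (matZ t L lam v h).submatrix Fin.succ Fin.succ = matM t L lam h := by
  ext a b
  simp [matM, matZ, matB, symOuter, xVec, Matrix.vecMulVec_apply]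

end

end LongSteps

/-!
The matrix `M` and `φ φᵀ` are symmetric, so it is enough to compare quadratic forms: with
`P_j = ∑_{m < j} h_m g_m`, the theorem says that
`∑ λ_{i,j} (g_j (P_j - P_i) + (g_i - g_j)² / 2) = (φ · g)² / 2` for every vector `g` (`matM_form`).
The left side is summed row by row, along the dyadic structure of the pattern.

* A block is a run of `2^l - 1` positions with step sizes `π^(l)`. If the rows in it have the vectors
  `s^(2p) ρ_ν`, their sum completed by a suitable left part of a row at the right end of the block is
  a combination of `S²`, `S g_R`, `g_R²` and `J`, where `R` is the right end, `S = ∑ β g` and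
  `J = ∑ β (g_j (P_j - P_b) + g_j² / 2)` (`BetaSteps.block_eq`). The induction on `l` halves the
  block. It works as the left part of `ρ_l` is self-similar (`leftDot_succ`), so that the row at the
  midpoint supplies exactly the left part that the left half needs (`ldot_rho`).
* The first half of the pattern consists of the blocks `π^(l)` behind the steps `α_l`. Adding these
  blocks and the rows at the powers of two one after the other, everything cancels except for
  a multiple of `g²` at the last position (`PatternSteps.left_half`).
* The second half is built from its end. Each new block, with the row at `α_l` behind it, enlarges
  the square `(w_l · g)² / 2` to `(w_{l+1} · g)² / 2` (`PatternSteps.right_half`).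
* The row at `μ_k` joins the halves to the square `(√(μ_k - 1) g + w_k · g)² / 2`
  (`PatternSteps.total`).

The cancellations rest on the recursion `μ_{l+1} = μ_l + 2 α_l + 2 s^l - 2` and the equation of
`α_l`. They give `(α_l - 1) √(μ_{l+1} - 1) = s^l √(μ_l - 1)` and that the entries of `w_l` sum to
`√(μ_l - 1)`.
-/

namespace LongSteps

noncomputable section

/-! ### The silver ratio, weighted sums over lists and the scalar recursions -/

/-- The silver ratio `s = 1 + √2`. Negative powers of `s` are avoided by `s⁻¹ = s - 2`, and
`s² = 2s + 1` is the only relation used. -/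
def silver : ℝ := 1 + √2

theorem silver_sq : silver ^ 2 = 2 * silver + 1 := by
  have h : √2 ^ 2 = (2 : ℝ) := Real.sq_sqrt (by norm_num)
  unfold silver
  linear_combination h

theorem silver_pos : 0 < silver := by unfold silver; positivity

theorem silver_ne_zero : silver ≠ 0 := silver_pos.ne'

theorem silver_inv : silver⁻¹ = silver - 2 := by
  have h := silver_ne_zero
  field_simp
  linear_combination -silver_sq

theorem silver_zpow_sub_one (n : ℕ) : silver ^ ((n : ℤ) - 1) = silver ^ n * (silver - 2) := by
  rw [zpow_sub_one₀ silver_ne_zero, zpow_natCast, silver_inv]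

theorem beta_eq (i : ℕ) : beta i = 1 + silver ^ i * (silver - 2) := by
  rw [← silver_zpow_sub_one]; rfl

theorem beta_succ (i : ℕ) : beta (i + 1) = 1 + silver ^ i := by
  rw [beta_eq]; linear_combination silver ^ i * silver_sq

/-- The sum `∑ v_q f q` over the entries of the vector `v`. -/
def ldot : List ℝ → (ℕ → ℝ) → ℝ
  | [], _ => 0
  | a :: v, f => a * f 0 + ldot v fun q => f (q + 1)

@[simp] theorem ldot_nil (f : ℕ → ℝ) : ldot [] f = 0 := rfl

@[simp] theorem ldot_singleton (a : ℝ) (f : ℕ → ℝ) : ldot [a] f = a * f 0 := by simp [ldot]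

theorem ldot_append (u v : List ℝ) (f : ℕ → ℝ) :
    ldot (u ++ v) f = ldot u f + ldot v fun q => f (u.length + q) := by
  induction u generalizing f with
  | nil => simp
  | cons a u ih =>
    simp only [List.cons_append, ldot, ih, List.length_cons]
    rw [add_assoc]
    congr 3
    funext q
    congr 1
    omega

theorem ldot_scale (c : ℝ) (v : List ℝ) (f : ℕ → ℝ) : ldot (scale c v) f = c * ldot v f := by
  unfold scale
  induction v generalizing f with
  | nil => simp
  | cons a v ih => simp only [List.map_cons, ldot, ih]; ring

theorem ldot_diff (u v : List ℝ) (f : ℕ → ℝ) (h : u.length = v.length) :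
    ldot (diff u v) f = ldot u f - ldot v f := by
  unfold diff
  induction u generalizing v f with
  | nil => cases v <;> simp_all
  | cons a u ih =>
    cases v with
    | nil => simp at h
    | cons b v =>
      simp only [List.zipWith_cons_cons, ldot, ih v _ (by simpa using h)]; ring

theorem ldot_fun_add (v : List ℝ) (f g : ℕ → ℝ) :
    ldot v (fun q => f q + g q) = ldot v f + ldot v g := by
  induction v generalizing f g with
  | nil => simp
  | cons a v ih => simp only [ldot, ih]; ring

theorem ldot_fun_mul (v : List ℝ) (c : ℝ) (f : ℕ → ℝ) :
    ldot v (fun q => c * f q) = c * ldot v f := by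
  induction v generalizing f with
  | nil => simp
  | cons a v ih => simp only [ldot, ih]; ring

theorem ldot_eq_sum (v : List ℝ) (f : ℕ → ℝ) (n : ℕ) (hn : v.length ≤ n) :
    ∑ q ∈ Finset.range n, v.getD q 0 * f q = ldot v f := by
  induction v generalizing f n with
  | nil => simp
  | cons a v ih =>
    obtain _ | n := n
    · simp at hn
    · rw [Finset.sum_range_succ']
      simp only [List.getD_cons_succ, List.getD_cons_zero, ldot]
      rw [ih (fun q => f (q + 1)) n (by simpa using hn)]
      ring

@[simp] theorem length_scale (c : ℝ) (v : List ℝ) : (scale c v).length = v.length := by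
  simp [scale]

theorem length_diff (u v : List ℝ) (h : u.length = v.length) :
    (diff u v).length = v.length := by
  simp [diff, h]

@[simp] theorem length_piVec (l : ℕ) : (piVec l).length = 2 ^ l - 1 := by simp [piVec]

@[simp] theorem length_sigma (l : ℕ) : (sigma (l + 1)).length = 2 ^ l - 1 := by
  induction l with
  | zero => simp [sigma]
  | succ l ih =>
    have := Nat.one_le_two_pow (n := l)
    simp only [sigma, length_scale, List.length_append, length_piVec, List.length_singleton, ih]
    omega

@[simp] theorem length_w (l : ℕ) : (w l).length = 2 ^ l := by
  induction l with
  | zero => simp [w]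
  | succ l ih =>
    have := Nat.one_le_two_pow (n := l)
    simp only [w, length_scale, List.length_append, length_piVec, List.length_singleton, ih]
    omega

theorem nu_two_pow (l : ℕ) : nu (2 ^ l) = l := padicValNat.prime_pow l

theorem nu_two_pow_mul_add (l c r : ℕ) (hr : 0 < r) (hrl : r < 2 ^ l) :
    nu (2 ^ l * c + r) = nu r := by
  obtain ⟨a, b, hb, rfl⟩ := Nat.exists_eq_two_pow_mul_odd hr.ne'
  have hal : a < l := by
    rw [← Nat.pow_lt_pow_iff_right (a := 2) (by norm_num)]
    exact lt_of_le_of_lt (Nat.le_mul_of_pos_right _ hb.pos) hrl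
  obtain ⟨d, rfl⟩ := Nat.exists_eq_add_of_lt hal
  have key : ∀ b : ℕ, Odd b → nu (2 ^ a * b) = a := by
    intro b hb
    unfold nu
    rw [padicValNat.mul (by positivity) hb.pos.ne', padicValNat.prime_pow,
      padicValNat.eq_zero_of_not_dvd hb.not_two_dvd_nat, add_zero]
  rw [key b hb]
  have : 2 ^ (a + d + 1) * c + 2 ^ a * b = 2 ^ a * (2 * (2 ^ d * c) + b) := by ring
  rw [this, key _ ((even_two_mul _).add_odd hb)]

theorem piVec_succ (l : ℕ) : piVec (l + 1) = piVec l ++ [beta l] ++ piVec l := by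
  have h1 := Nat.one_le_two_pow (n := l)
  have e : 2 ^ (l + 1) - 1 = (2 ^ l - 1) + 1 + (2 ^ l - 1) := by omega
  unfold piVec
  rw [e, List.range_add, List.range_add, List.map_append, List.map_append]
  congr 1
  · congr 1
    have : 2 ^ l - 1 + 1 = 2 ^ l := by omega
    simp [this, nu_two_pow]
  · rw [List.map_map]
    refine List.map_congr_left fun r hr => ?_
    have hr : r < 2 ^ l - 1 := by simpa using hr
    have h : 2 ^ l - 1 + 1 + r + 1 = 2 ^ l * 1 + (r + 1) := by omega
    simp only [Function.comp]
    rw [h, nu_two_pow_mul_add l 1 (r + 1) (by omega) (by omega)]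

theorem ldot_piVec_succ (l : ℕ) (f : ℕ → ℝ) :
    ldot (piVec (l + 1)) f =
      ldot (piVec l) f + beta l * f (2 ^ l - 1) + ldot (piVec l) fun q => f (2 ^ l + q) := by
  have h1 := Nat.one_le_two_pow (n := l)
  have e : 2 ^ l - 1 + 1 = 2 ^ l := by omega
  rw [piVec_succ, ldot_append, ldot_append, ldot_singleton]
  simp [e]

/-- The sum of the entries of `π^(l)` is `s ^ l - 1`. -/
theorem ldot_piVec_one (l : ℕ) : ldot (piVec l) (fun _ => 1) = silver ^ l - 1 := by
  induction l with
  | zero => simp [piVec]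
  | succ l ih =>
    rw [ldot_piVec_succ, ih, beta_eq, mul_one, pow_succ]; ring

/-- The number of ones in the binary expansion of `n`, so that `p i = ones (i + 1)`. -/
def ones (n : ℕ) : ℕ := (Nat.digits 2 n).count 1

theorem ones_bit (n b : ℕ) (hb : b < 2) : ones (2 * n + b) = b + ones n := by
  rcases Nat.eq_zero_or_pos (2 * n + b) with h | h
  · obtain rfl : b = 0 := by omega
    obtain rfl : n = 0 := by omega
    simp
  · unfold ones
    rw [Nat.digits_def' (by norm_num) h, List.count_cons]
    have h1 : (2 * n + b) % 2 = b := by omega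
    have h2 : (2 * n + b) / 2 = n := by omega
    rw [h1, h2]
    interval_cases b <;> simp [add_comm]

theorem ones_two_pow_mul_add (l c r : ℕ) (hr : r < 2 ^ l) :
    ones (2 ^ l * c + r) = ones c + ones r := by
  induction l generalizing r with
  | zero => 
    obtain rfl : r = 0 := by simpa using hr
    simp [ones]
  | succ l ih =>
    rw [pow_succ] at hr
    have h1 : 2 ^ (l + 1) * c + r = 2 * (2 ^ l * c + r / 2) + r % 2 := by
      rw [pow_succ]; have := Nat.div_add_mod r 2; linarith
    have h2 := ones_bit (r / 2) (r % 2) (Nat.mod_lt _ (by norm_num))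
    rw [Nat.div_add_mod] at h2
    rw [h1, ones_bit _ _ (Nat.mod_lt _ (by norm_num)), ih _ (by omega), h2]
    ring

theorem ones_one : ones 1 = 1 := by simp [ones]

theorem ones_two_pow_sub_one (j : ℕ) : ones (2 ^ j - 1) = j := by
  induction j with
  | zero => simp [ones]
  | succ j ih =>
    have h1 := Nat.one_le_two_pow (n := j)
    have h : 2 ^ (j + 1) - 1 = 2 * (2 ^ j - 1) + 1 := by omega
    rw [h, ones_bit _ _ (by norm_num), ih]; ring

theorem mu_gt_one (i : ℕ) : 1 < mu i := muOf_gt_one i _ fun l => (alpha_spec l.1).1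

theorem mu_zero : mu 0 = 2 := by simp [mu, muOf]

theorem sum_two_pow_mul_beta (i : ℕ) :
    ∑ l ∈ Finset.range i, (2 : ℝ) ^ (i - 1 - l) * beta l = silver ^ i - 1 := by
  induction i with
  | zero => simp
  | succ i ih =>
    rw [Finset.sum_range_succ]
    have : ∀ l ∈ Finset.range i,
        (2 : ℝ) ^ (i + 1 - 1 - l) * beta l = 2 * ((2 : ℝ) ^ (i - 1 - l) * beta l) := by
      intro l hl
      have hl := Finset.mem_range.1 hl
      have h : i + 1 - 1 - l = (i - 1 - l) + 1 := by omega
      rw [h, pow_succ]; ring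
    rw [Finset.sum_congr rfl this, ← Finset.mul_sum, ih, beta_eq]
    simp
    ring

/-- The defining sum of `μ` as a one-step recursion: the sum of the entries of `π^(i)` enters once on
each side of the pattern. -/
theorem mu_succ (i : ℕ) : mu (i + 1) = mu i + 2 * alpha i + 2 * silver ^ i - 2 := by
  have hB := sum_two_pow_mul_beta i
  unfold mu muOf
  rw [Fin.sum_univ_castSucc]
  simp only [Fin.val_castSucc, Fin.val_last, Nat.add_sub_cancel]
  have h : ∑ l ∈ Finset.range i, 2 * ((2 : ℝ) ^ (i + 1 - l - 1) - 1) * beta l =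
      ∑ l ∈ Finset.range (i - 1), 2 * ((2 : ℝ) ^ (i - l - 1) - 1) * beta l +
        2 * ∑ l ∈ Finset.range i, (2 : ℝ) ^ (i - 1 - l) * beta l := by
    have e : ∑ l ∈ Finset.range (i - 1), 2 * ((2 : ℝ) ^ (i - l - 1) - 1) * beta l =
        ∑ l ∈ Finset.range i, 2 * ((2 : ℝ) ^ (i - l - 1) - 1) * beta l := by
      refine Finset.sum_subset (Finset.range_subset_range.2 (by omega)) fun l h1 h2 => ?_
      have : i - l - 1 = 0 := by simp at h1 h2; omega
      simp [this]
    rw [e, Finset.mul_sum, ← Finset.sum_add_distrib]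
    refine Finset.sum_congr rfl fun l hl => ?_
    have hl := Finset.mem_range.1 hl
    have h1 : i + 1 - l - 1 = (i - l - 1) + 1 := by omega
    have h2 : i - 1 - l = i - l - 1 := by omega
    rw [h1, h2, pow_succ]
    ring
  rw [h, hB]
  ring

theorem alpha_quad (i : ℕ) :
    2 * (alpha i - 1) ^ 2 + (mu i - 1) * (alpha i - 1) = silver ^ i * (mu i - 1) := by
  have h := (alpha_spec i).2
  rw [quad, beta_succ] at h
  linear_combination h

/-- The identity that makes the cross terms between a step `α_i` and the block after it cancel in the
first half of the pattern. -/
theorem mu_succ_mul (i : ℕ) :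
    (mu (i + 1) - 1) * (silver ^ i - (alpha i - 1)) = 2 * silver ^ (2 * i) := by
  rw [mu_succ, mul_comm 2 i, pow_mul]
  linear_combination -alpha_quad i

theorem sqrt_mu_pos (i : ℕ) : 0 < √(mu i - 1) := Real.sqrt_pos.2 (by linarith [mu_gt_one i])

theorem sq_sqrt_mu (i : ℕ) : √(mu i - 1) ^ 2 = mu i - 1 :=
  Real.sq_sqrt (by linarith [mu_gt_one i])

/-- The identity that makes the cross terms between a step `α_i` and the tail `w_i` match in the
second half of the pattern. -/
theorem alpha_mul_sqrt_mu_succ (i : ℕ) :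
    (alpha i - 1) * √(mu (i + 1) - 1) = silver ^ i * √(mu i - 1) := by
  have h1 := (alpha_spec i).1
  have h2 := sqrt_mu_pos i
  have h3 := sqrt_mu_pos (i + 1)
  have h4 := silver_pos
  refine (pow_left_inj₀ (mul_nonneg (by linarith) h3.le) (by positivity) two_ne_zero).1 ?_
  rw [mul_pow, mul_pow, sq_sqrt_mu, sq_sqrt_mu, mu_succ]
  linear_combination (alpha i - 1 + silver ^ i) * alpha_quad i

theorem sqrt_mu_succ_sub (i : ℕ) :
    √(mu (i + 1) - 1) * (√(mu (i + 1) - 1) - √(mu i - 1)) = 2 * silver ^ i := by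
  have h1 := (alpha_spec i).1
  have h : (alpha i - 1) * (√(mu (i + 1) - 1) * √(mu i - 1)) = silver ^ i * (mu i - 1) := by
    linear_combination silver ^ i * sq_sqrt_mu i + √(mu i - 1) * alpha_mul_sqrt_mu_succ i
  have h2 : √(mu (i + 1) - 1) * √(mu i - 1) = mu i - 1 + 2 * (alpha i - 1) := by
    have : alpha i - 1 ≠ 0 := by linarith
    refine mul_left_cancel₀ this ?_
    rw [h]; linear_combination -alpha_quad i
  have h3 := sq_sqrt_mu (i + 1)
  have h4 := mu_succ i
  linear_combination h3 - h2 + h4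

/-- The sum of the entries of `w_l` is `√(μ_l - 1)`. -/
theorem ldot_w_one (l : ℕ) : ldot (w l) (fun _ => 1) = √(mu l - 1) := by
  induction l with
  | zero => norm_num [w, mu_zero]
  | succ l ih =>
    have h := sqrt_mu_succ_sub l
    have h3 := (sqrt_mu_pos (l + 1)).ne'
    rw [w, ldot_append, ldot_append, ldot_scale, ldot_piVec_one, ldot_singleton, ih, beta_succ]
    field_simp
    linear_combination -h

/-- The sum `∑ v_q f q` for `v = s^(2l+1) σ^(l+1) - π^(l) / (2s)`, the part of `ρ_(l+1)` strictly
between its first entry and the diagonal; note `1 / (2s) = (s - 2) / 2`. -/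
def leftDot (l : ℕ) (f : ℕ → ℝ) : ℝ :=
  silver ^ (2 * l + 1) * ldot (sigma (l + 1)) f - (silver - 2) / 2 * ldot (piVec l) f

theorem leftDot_zero (f : ℕ → ℝ) : leftDot 0 f = 0 := by simp [leftDot, sigma, piVec]

/-- The left part of `ρ` is self-similar: up to the weights `π` of the whole block and one extra weight
at its midpoint, it is `s²` times the left part one level below, placed on the right half. -/
theorem leftDot_succ (l : ℕ) (f : ℕ → ℝ) :
    leftDot (l + 1) f = ldot (piVec (l + 1)) f + silver ^ (l + 1) * f (2 ^ l - 1) +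
      silver ^ 2 * leftDot l fun q => f (2 ^ l + q) := by
  have h1 := Nat.one_le_two_pow (n := l)
  have e : 2 ^ l - 1 + 1 = 2 ^ l := by omega
  have hs := silver_sq
  have h0 := silver_ne_zero
  have hz : (1 + √2 : ℝ) ^ (-2 * ((l : ℤ) + 1)) = (silver ^ (2 * (l + 1)))⁻¹ := by
    rw [← zpow_natCast, ← zpow_neg]; congr 1
  have hz2 : (1 + √2 : ℝ) ^ (2 * ((l : ℤ) + 1)) = silver ^ (2 * (l + 1)) := by
    rw [← zpow_natCast, silver]; norm_cast
  unfold leftDot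
  rw [sigma, ldot_scale, ldot_append, ldot_append, ldot_scale, ldot_singleton, hz, hz2,
    ldot_piVec_succ, beta_succ, beta_eq]
  simp only [List.length_append, length_piVec, List.length_singleton, e, add_zero]
  have h2 : silver ^ (2 * (l + 1) + 1) = silver ^ (2 * (l + 1)) * silver := pow_succ _ _
  have h3 : silver ^ (2 * l + 1) * silver ^ 2 = silver ^ (2 * (l + 1)) * silver := by ring
  have h4 : silver ^ (2 * (l + 1)) ≠ 0 := pow_ne_zero _ h0
  have h5 : (silver ^ (2 * (l + 1)))⁻¹ * silver ^ (2 * (l + 1)) = 1 := inv_mul_cancel₀ h4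
  rw [h2, pow_succ silver l]
  set A := ldot (piVec l) f
  set B := ldot (piVec l) fun q => f (2 ^ l + q)
  set C := ldot (sigma (l + 1)) fun q => f (2 ^ l + q)
  set D := f (2 ^ l - 1)
  set E := silver ^ (2 * (l + 1))
  linear_combination (1 / 2 * silver * (A + (1 + silver ^ (l + 1)) * D) + E * silver * C) * h5
    - C * h3 + silver / 2 * B * hs

/-! ### Blocks with step sizes `β` -/

/-- The contribution of a unit multiplier `λ_(i,j)` to `L` times the quadratic form of `M`. Here `g j`
is the value of the gradient coordinate and `P j` stands for `∑_{m < j} h_m g_m`, that is, for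
`L (x_0 - x_j)`. -/
def cocoTerm (g P : ℕ → ℝ) (i j : ℕ) : ℝ := g j * (P j - P i) + (g i - g j) ^ 2 / 2

/-- The linear form `∑ v_q g_(b+q)` of the vector `v` placed at position `b`. -/
def linSum (g : ℕ → ℝ) (v : List ℝ) (b : ℕ) : ℝ := ldot v fun q => g (b + q)

/-- The terms `∑ v_q (g_j (P_j - P_b) + g_j² / 2)`, `j = b + q`, of the vector `v` placed at position
`b`. With `linSum` and the sum of the entries, it determines every sum of `cocoTerm`s with weights `v`. -/
def quadSum (g P : ℕ → ℝ) (v : List ℝ) (b : ℕ) : ℝ :=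
  ldot v fun q => g (b + q) * (P (b + q) - P b) + g (b + q) ^ 2 / 2

theorem ldot_cocoTerm (g P : ℕ → ℝ) (v : List ℝ) (i b : ℕ) :
    ldot v (fun q => cocoTerm g P i (b + q)) =
      quadSum g P v b + (P b - P i - g i) * linSum g v b + g i ^ 2 / 2 * ldot v fun _ => 1 := by
  unfold linSum quadSum
  rw [← ldot_fun_mul, ← ldot_fun_mul, ← ldot_fun_add, ← ldot_fun_add]
  congr 1
  funext q
  unfold cocoTerm
  ring

theorem linSum_append (g : ℕ → ℝ) (u v : List ℝ) (b : ℕ) :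
    linSum g (u ++ v) b = linSum g u b + linSum g v (b + u.length) := by
  simp only [linSum, ldot_append, add_assoc]

theorem quadSum_append (g P : ℕ → ℝ) (u v : List ℝ) (b : ℕ) :
    quadSum g P (u ++ v) b = quadSum g P u b + quadSum g P v (b + u.length) +
      (P (b + u.length) - P b) * linSum g v (b + u.length) := by
  unfold quadSum linSum
  rw [ldot_append, ← ldot_fun_mul, add_assoc, ← ldot_fun_add]
  congr 2
  funext q
  simp only [add_assoc]
  ring

/-- On the `2^l - 1` positions from `b` on, the step sizes are `β_ν(1), β_ν(2), …`, the entries of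
`π^(l)`. -/
def BetaSteps (g P : ℕ → ℝ) (b l : ℕ) : Prop :=
  ∀ r, r < 2 ^ l - 1 → P (b + r + 1) = P (b + r) + beta (nu (r + 1)) * g (b + r)

theorem BetaSteps.left {g P : ℕ → ℝ} {b l : ℕ} (h : BetaSteps g P b (l + 1)) :
    BetaSteps g P b l := fun r hr => h r (by rw [pow_succ]; omega)

theorem BetaSteps.right {g P : ℕ → ℝ} {b l : ℕ} (h : BetaSteps g P b (l + 1)) :
    BetaSteps g P (b + 2 ^ l) l := fun r hr => by
  have h1 := h (2 ^ l + r) (by rw [pow_succ]; omega)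
  have h2 := nu_two_pow_mul_add l 1 (r + 1) (by omega) (by omega)
  rw [mul_one, ← add_assoc] at h2
  rw [h2, ← add_assoc] at h1
  exact h1

theorem BetaSteps.mid {g P : ℕ → ℝ} {b l : ℕ} (h : BetaSteps g P b (l + 1)) :
    P (b + 2 ^ l) = P (b + (2 ^ l - 1)) + beta l * g (b + (2 ^ l - 1)) := by
  have h1 := Nat.one_le_two_pow (n := l)
  have h2 := h (2 ^ l - 1) (by rw [pow_succ]; omega)
  have e : 2 ^ l - 1 + 1 = 2 ^ l := by omega
  rwa [e, nu_two_pow, add_assoc, e] at h2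

theorem linSum_piVec_succ (g : ℕ → ℝ) (l b : ℕ) :
    linSum g (piVec (l + 1)) b =
      linSum g (piVec l) b + beta l * g (b + (2 ^ l - 1)) + linSum g (piVec l) (b + 2 ^ l) := by
  simp only [linSum, ldot_piVec_succ, add_assoc]

/-- `P` increases over a block by the linear form of `π`. -/
theorem BetaSteps.total {g P : ℕ → ℝ} {b l : ℕ} (h : BetaSteps g P b l) :
    P (b + (2 ^ l - 1)) = P b + linSum g (piVec l) b := by
  induction l generalizing b with
  | zero => simp [linSum, piVec]
  | succ l ih =>
    have h1 := Nat.one_le_two_pow (n := l)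
    have e : b + (2 ^ (l + 1) - 1) = b + 2 ^ l + (2 ^ l - 1) := by rw [pow_succ]; omega
    rw [e, ih h.right, h.mid, ih h.left, linSum_piVec_succ]
    ring

theorem BetaSteps.quadSum_succ {g P : ℕ → ℝ} {b l : ℕ} (h : BetaSteps g P b (l + 1)) :
    quadSum g P (piVec (l + 1)) b =
      quadSum g P (piVec l) b +
      beta l * (g (b + (2 ^ l - 1)) * linSum g (piVec l) b + g (b + (2 ^ l - 1)) ^ 2 / 2) +
      quadSum g P (piVec l) (b + 2 ^ l) +
      (linSum g (piVec l) b + beta l * g (b + (2 ^ l - 1))) * linSum g (piVec l) (b + 2 ^ l) := by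
  have h1 := Nat.one_le_two_pow (n := l)
  have e : b + (piVec l ++ [beta l]).length = b + 2 ^ l := by simp; omega
  rw [piVec_succ, quadSum_append, quadSum_append, e, h.mid, length_piVec, h.left.total]
  simp [quadSum, linSum, h.left.total]
  ring

/-- A row with vector `ρ_l` at the midpoint `b + (2^l - 1)` of a block of level `l + 1`: by the
self-similarity of `leftDot`, `s²` times its left part is the difference of `leftDot l` and `π^(l)` on
the left half of the block. So it completes the rows of the left half to the closed form of
`BetaSteps.block_eq`. -/
theorem ldot_rho (g P : ℕ → ℝ) (l b : ℕ) :
    silver ^ 2 * ldot (rho l)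
        (fun q => cocoTerm g P (b + (2 ^ l - 1)) (b + (2 ^ l - 1) + q - 2 ^ l / 2)) =
      leftDot l (fun q => cocoTerm g P (b + (2 ^ l - 1)) (b + q)) -
        ldot (piVec l) (fun q => cocoTerm g P (b + (2 ^ l - 1)) (b + q)) +
        silver ^ 2 * (ldot (piVec l) (fun q => cocoTerm g P (b + (2 ^ l - 1)) (b + 2 ^ l + q)) +
          cocoTerm g P (b + (2 ^ l - 1)) (b + 2 ^ l + (2 ^ l - 1))) := by
  generalize hF : cocoTerm g P (b + (2 ^ l - 1)) = F
  obtain _ | l := l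
  · simp [leftDot_zero, rho, piVec, ldot]
  have h1 := Nat.one_le_two_pow (n := l)
  have h2 : 2 ^ (l + 1) = 2 * 2 ^ l := by ring
  have hd : (diff (scale ((1 + √2) ^ (2 * (l : ℤ) + 1)) (sigma (l + 1)))
      (scale (1 / (2 * (1 + √2))) (piVec l))).length = 2 ^ l - 1 := by
    rw [length_diff] <;> simp
  rw [leftDot_succ, rho, ldot_append, ldot_append, ldot_append, ldot_append]
  simp only [List.length_append, hd, List.length_singleton, length_piVec, ldot_singleton,
    zero_mul, one_mul, add_zero]
  rw [ldot_diff _ _ _ (by simp), ldot_scale, ldot_scale]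
  have e1 : b + (2 ^ (l + 1) - 1) - 2 ^ (l + 1) / 2 = b + (2 ^ l - 1) := by omega
  have e2 : ∀ q, b + (2 ^ (l + 1) - 1) + (1 + q) - 2 ^ (l + 1) / 2 = b + (2 ^ l + q) := by omega
  have e3 : ∀ q, b + (2 ^ (l + 1) - 1) + (1 + (2 ^ l - 1) + 1 + q) - 2 ^ (l + 1) / 2 =
      b + 2 ^ (l + 1) + q := by omega
  have e4 : b + (2 ^ (l + 1) - 1) + (1 + (2 ^ l - 1) + 1 + (2 ^ (l + 1) - 1)) - 2 ^ (l + 1) / 2 =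
      b + 2 ^ (l + 1) + (2 ^ (l + 1) - 1) := by omega
  simp only [e1, e2, e3]
  have hz1 : (1 + √2 : ℝ) ^ ((l : ℤ) - 1) = silver ^ l * (silver - 2) := silver_zpow_sub_one l
  have hz2 : (1 + √2 : ℝ) ^ (2 * (l : ℤ) + 1) = silver ^ (2 * l + 1) := by
    rw [← zpow_natCast, silver]; norm_cast
  have hz3 : 1 / (2 * (1 + √2 : ℝ)) = (silver - 2) / 2 := by
    rw [← silver_inv, silver]; field_simp
  rw [hz1, hz2, hz3, leftDot]
  linear_combination silver ^ l * F (b + (2 ^ l - 1)) * silver * silver_sq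

/-- The rows inside a block, with vectors `ρ` and factors `s^(2 ones)`, together with the left part of
a row at the right end of the block, have a closed form that involves the block only through
`linSum` and `quadSum` of `π^(l)`. Without the left part added, no such form is available, as the
rows alone do not treat the positions of the block alike. -/
theorem BetaSteps.block_eq {g P : ℕ → ℝ} {b l : ℕ} (h : BetaSteps g P b l) :
    ∑ r ∈ Finset.range (2 ^ l - 1), silver ^ (2 * ones (r + 1)) *
        ldot (rho (nu (r + 1))) (fun q => cocoTerm g P (b + r) (b + r + q - 2 ^ nu (r + 1) / 2)) +
      leftDot l (fun q => cocoTerm g P (b + (2 ^ l - 1)) (b + q)) =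
    -(linSum g (piVec l) b) ^ 2 / 2 +
      (silver - 1) / 2 * ((linSum g (piVec l) b) ^ 2 - 2 * quadSum g P (piVec l) b) -
      g (b + (2 ^ l - 1)) * linSum g (piVec l) b +
      (silver ^ (2 * l + 1) - silver ^ l * (silver - 1) - 1) / 2 * g (b + (2 ^ l - 1)) ^ 2 := by
  induction l generalizing b with
  | zero => simp [leftDot_zero, linSum, quadSum, piVec]
  | succ l ih =>
    have h1 := Nat.one_le_two_pow (n := l)
    have h2 : 2 ^ (l + 1) = 2 * 2 ^ l := by ring
    have e : 2 ^ (l + 1) - 1 = (2 ^ l - 1) + 1 + (2 ^ l - 1) := by omega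
    have e0 : 2 ^ l - 1 + 1 = 2 ^ l := by omega
    have eR : b + (2 ^ l - 1 + 1 + (2 ^ l - 1)) = b + 2 ^ l + (2 ^ l - 1) := by omega
    have hr : ∑ r ∈ Finset.range (2 ^ l - 1), silver ^ (2 * ones (2 ^ l - 1 + 1 + r + 1)) *
        ldot (rho (nu (2 ^ l - 1 + 1 + r + 1))) (fun q => cocoTerm g P (b + (2 ^ l - 1 + 1 + r))
          (b + (2 ^ l - 1 + 1 + r) + q - 2 ^ nu (2 ^ l - 1 + 1 + r + 1) / 2)) =
        silver ^ 2 * ∑ r ∈ Finset.range (2 ^ l - 1), silver ^ (2 * ones (r + 1)) *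
          ldot (rho (nu (r + 1))) (fun q => cocoTerm g P (b + 2 ^ l + r)
            (b + 2 ^ l + r + q - 2 ^ nu (r + 1) / 2)) := by
      rw [Finset.mul_sum]
      refine Finset.sum_congr rfl fun r hr => ?_
      have hr := Finset.mem_range.1 hr
      have i1 : 2 ^ l - 1 + 1 + r + 1 = 2 ^ l * 1 + (r + 1) := by omega
      have i2 : b + (2 ^ l - 1 + 1 + r) = b + 2 ^ l + r := by omega
      rw [i1, i2, nu_two_pow_mul_add l 1 (r + 1) (by omega) (by omega),
        ones_two_pow_mul_add l 1 (r + 1) (by omega), ones_one]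
      ring
    have hm := ldot_rho g P l b
    have ho : ones (2 ^ l) = 1 := by
      have := ones_two_pow_mul_add l 1 0 (by omega)
      simpa [ones] using this
    have ihl := ih h.left
    have ihr := ih h.right
    rw [e, Finset.sum_range_add, Finset.sum_range_succ, hr, eR]
    simp only [e0, nu_two_pow, ho, mul_one]
    rw [hm, leftDot_succ]
    have p1 := h.left.total
    have p2 := h.mid
    have p3 := h.right.total
    simp only [ldot_cocoTerm, linSum_piVec_succ, h.quadSum_succ, ldot_piVec_one]
    generalize linSum g (piVec l) b = S₁ at *
    generalize linSum g (piVec l) (b + 2 ^ l) = S₂ at *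
    generalize quadSum g P (piVec l) b = J₁ at *
    generalize quadSum g P (piVec l) (b + 2 ^ l) = J₂ at *
    have hp : silver ^ (2 * (l + 1) + 1) = silver ^ 2 * silver ^ (2 * l + 1) := by ring
    have hq : silver ^ (l + 1) = silver * silver ^ l := by ring
    have hu : silver ^ (2 * l + 1) = silver * (silver ^ l) ^ 2 := by ring
    simp only [cocoTerm, ← add_assoc, p3, p2, p1, beta_eq, hp, hq] at ihl ihr ⊢
    generalize g (b + (2 ^ l - 1)) = x at *
    generalize g (b + 2 ^ l + (2 ^ l - 1)) = y at *
    generalize silver ^ l = t at *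
    generalize silver ^ (2 * l + 1) = u at *
    have hs := silver_sq
    linear_combination ihl + silver ^ 2 * ihr + x ^ 2 / 2 * hu +
      silver * (x * t * S₂ + x * t * y - t * y ^ 2 / 2 - J₂ + S₂ ^ 2 / 2 - x ^ 2 * t ^ 2 / 2) * hs

/-! ### The step sizes along the pattern -/

theorem getD_piVec (l r : ℕ) (hr : r < 2 ^ l - 1) : (piVec l).getD r 0 = beta (nu (r + 1)) := by
  simp [piVec, List.getD_eq_getElem?_getD, hr]

/-- The entries of the pattern before `μ_k`. -/
def upList (k : ℕ) : List ℝ := (List.range k).flatMap fun l => [alpha l] ++ piVec l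

/-- The entries of the pattern after `μ_k`. -/
def downList (k : ℕ) : List ℝ := (List.range k).reverse.flatMap fun l => piVec l ++ [alpha l]

theorem upList_succ (k : ℕ) : upList (k + 1) = upList k ++ ([alpha k] ++ piVec k) := by
  simp [upList, List.range_succ]

theorem downList_succ (k : ℕ) : downList (k + 1) = piVec k ++ ([alpha k] ++ downList k) := by
  simp [downList, List.range_succ]

theorem length_upList (k : ℕ) : (upList k).length = 2 ^ k - 1 := by
  induction k with
  | zero => simp [upList]
  | succ k ih =>
    have := Nat.one_le_two_pow (n := k)
    simp only [upList_succ, List.length_append, ih, length_piVec, List.length_singleton]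
    omega

/-- The entry at `2^l - 1` is `α_l`, and a copy of `π^(l)` follows it. -/
theorem getD_upList (k l : ℕ) (hl : l < k) :
    (upList k).getD (2 ^ l - 1) 0 = alpha l ∧
      ∀ r, r < 2 ^ l - 1 → (upList k).getD (2 ^ l + r) 0 = beta (nu (r + 1)) := by
  induction k with
  | zero => omega
  | succ k ih =>
    have h1 := Nat.one_le_two_pow (n := l)
    rw [upList_succ]
    rcases Nat.lt_succ_iff_lt_or_eq.1 hl with hl | rfl
    · have h2 : 2 ^ (l + 1) ≤ 2 ^ k := Nat.pow_le_pow_right (by norm_num) hl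
      rw [pow_succ] at h2
      obtain ⟨i1, i2⟩ := ih hl
      refine ⟨?_, fun r hr => ?_⟩
      · rw [List.getD_append _ _ _ _ (by rw [length_upList]; omega), i1]
      · rw [List.getD_append _ _ _ _ (by rw [length_upList]; omega), i2 r hr]
    · refine ⟨?_, fun r hr => ?_⟩
      · rw [List.getD_append_right _ _ _ _ (by rw [length_upList]), length_upList]
        simp
      · rw [List.getD_append_right _ _ _ _ (by rw [length_upList]; omega), length_upList,
          ← getD_piVec _ r hr]
        have : 2 ^ l + r - (2 ^ l - 1) = r + 1 := by omega
        rw [this]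
        simp

/-- The last `2^(l+1) - 1` entries start with a copy of `π^(l)` and then `α_l`; they begin
at index `2^k - 2^(l+1)`, the length of `downList k` being `2^k - 1`. -/
theorem getD_downList (k l : ℕ) (hl : l < k) :
    (downList k).getD (2 ^ k - 2 ^ (l + 1) + (2 ^ l - 1)) 0 = alpha l ∧
      ∀ r, r < 2 ^ l - 1 →
        (downList k).getD (2 ^ k - 2 ^ (l + 1) + r) 0 = beta (nu (r + 1)) := by
  induction k with
  | zero => omega
  | succ k ih =>
    have h1 := Nat.one_le_two_pow (n := l)
    rw [downList_succ]
    rcases Nat.lt_succ_iff_lt_or_eq.1 hl with hl | rfl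
    · have h2 : 2 ^ (l + 1) ≤ 2 ^ k := Nat.pow_le_pow_right (by norm_num) hl
      have h3 : 2 ^ (k + 1) = 2 * 2 ^ k := by ring
      have e : ∀ r, 2 ^ (k + 1) - 2 ^ (l + 1) + r - (2 ^ k - 1) =
        (2 ^ k - 2 ^ (l + 1) + r) + 1 := by omega
      obtain ⟨i1, i2⟩ := ih hl
      refine ⟨?_, fun r hr => ?_⟩
      · rw [List.getD_append_right _ _ _ _ (by rw [length_piVec]; omega), length_piVec, e, ← i1]
        simp
      · rw [List.getD_append_right _ _ _ _ (by rw [length_piVec]; omega), length_piVec, e,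
          ← i2 r hr]
        simp
    · rw [Nat.sub_self]
      simp only [zero_add]
      refine ⟨?_, fun r hr => ?_⟩
      · rw [List.getD_append_right _ _ _ _ (by rw [length_piVec]), length_piVec]
        simp
      · rw [List.getD_append _ _ _ _ (by rw [length_piVec]; omega), getD_piVec _ r hr]

theorem patternList_eq (k : ℕ) : patternList k = upList k ++ ([mu k] ++ downList k) := by
  simp [patternList, upList, downList]

theorem getD_patternList_left (k i : ℕ) (hi : i < 2 ^ k - 1) :
    (patternList k).getD i 0 = (upList k).getD i 0 := by
  rw [patternList_eq, List.getD_append _ _ _ _ (by rwa [length_upList])]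

theorem getD_patternList_mid (k : ℕ) : (patternList k).getD (2 ^ k - 1) 0 = mu k := by
  rw [patternList_eq, List.getD_append_right _ _ _ _ (by rw [length_upList]), length_upList]
  simp

theorem getD_patternList_right (k i : ℕ) :
    (patternList k).getD (2 ^ k + i) 0 = (downList k).getD i 0 := by
  have h1 := Nat.one_le_two_pow (n := k)
  have : 2 ^ k + i - (2 ^ k - 1) = i + 1 := by omega
  rw [patternList_eq, List.getD_append_right _ _ _ _ (by rw [length_upList]; omega),
    length_upList, this]
  simp

/-- `P` is a sequence of partial sums of `h_j g_j` for the step sizes `h` of the pattern (with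
`h_j = 0` beyond its end). -/
def PatternSteps (k : ℕ) (g P : ℕ → ℝ) : Prop :=
  ∀ j, P (j + 1) = P j + (patternList k).getD j 0 * g j

variable {k l : ℕ} {g P : ℕ → ℝ}

theorem PatternSteps.left_block (h : PatternSteps k g P) (hl : l < k) :
    BetaSteps g P (2 ^ l) l := fun r hr => by
  have h2 : 2 ^ (l + 1) ≤ 2 ^ k := Nat.pow_le_pow_right (by norm_num) hl
  rw [pow_succ] at h2
  rw [h, getD_patternList_left _ _ (by omega), (getD_upList k l hl).2 r hr]

theorem PatternSteps.left_alpha (h : PatternSteps k g P) (hl : l < k) :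
    P (2 ^ l) = P (2 ^ l - 1) + alpha l * g (2 ^ l - 1) := by
  have h1 := Nat.one_le_two_pow (n := l)
  have h2 : 2 ^ (l + 1) ≤ 2 ^ k := Nat.pow_le_pow_right (by norm_num) hl
  rw [pow_succ] at h2
  rw [← (getD_upList k l hl).1, ← getD_patternList_left _ _ (by omega), ← h,
    Nat.sub_add_cancel h1]

theorem PatternSteps.mid (h : PatternSteps k g P) :
    P (2 ^ k) = P (2 ^ k - 1) + mu k * g (2 ^ k - 1) := by
  rw [← getD_patternList_mid, ← h, Nat.sub_add_cancel Nat.one_le_two_pow]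

theorem PatternSteps.right_block (h : PatternSteps k g P) (hl : l < k) :
    BetaSteps g P (2 ^ (k + 1) - 2 ^ (l + 1)) l := fun r hr => by
  have h2 : 2 ^ (l + 1) ≤ 2 ^ k := Nat.pow_le_pow_right (by norm_num) hl
  have e : 2 ^ (k + 1) - 2 ^ (l + 1) + r = 2 ^ k + (2 ^ k - 2 ^ (l + 1) + r) := by
    rw [pow_succ 2 k]; omega
  rw [h, e, getD_patternList_right, (getD_downList k l hl).2 r hr]

theorem PatternSteps.right_alpha (h : PatternSteps k g P) (hl : l < k) :
    P (2 ^ (k + 1) - 2 ^ l) = P (2 ^ (k + 1) - 2 ^ (l + 1) + (2 ^ l - 1)) +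
      alpha l * g (2 ^ (k + 1) - 2 ^ (l + 1) + (2 ^ l - 1)) := by
  have h1 := Nat.one_le_two_pow (n := l)
  have h2 : 2 ^ (l + 1) ≤ 2 ^ k := Nat.pow_le_pow_right (by norm_num) hl
  have e : 2 ^ (k + 1) - 2 ^ (l + 1) + (2 ^ l - 1) =
      2 ^ k + (2 ^ k - 2 ^ (l + 1) + (2 ^ l - 1)) := by
    rw [pow_succ 2 k]; omega
  have e2 : 2 ^ (k + 1) - 2 ^ l = 2 ^ k + (2 ^ k - 2 ^ (l + 1) + (2 ^ l - 1)) + 1 := by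
    rw [pow_succ] at *; omega
  rw [e, e2, h, getD_patternList_right, (getD_downList k l hl).1]

theorem length_rho (l : ℕ) : (rho l).length = 2 ^ l / 2 + 1 + 2 ^ l := by
  obtain _ | l := l
  · simp [rho]
  have h1 := Nat.one_le_two_pow (n := l)
  have hd : (diff (scale ((1 + √2) ^ (2 * (l : ℤ) + 1)) (sigma (l + 1)))
      (scale (1 / (2 * (1 + √2))) (piVec l))).length = 2 ^ l - 1 := by
    rw [length_diff] <;> simp
  simp only [rho, List.length_append, hd, List.length_singleton, length_piVec, pow_succ]
  omega

theorem length_rowVec (k i : ℕ) (hk : 1 ≤ k) :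
    (rowVec k i).length = 2 ^ nu (i + 1) / 2 + 1 + 2 ^ nu (i + 1) := by
  unfold rowVec
  generalize hl : nu (i + 1) = l
  have hw : i + 1 = 2 ^ k → l = k := fun h => by rw [← hl, h, nu_two_pow]
  have h1 := Nat.one_le_two_pow (n := l)
  simp only
  split_ifs with c1 c2 c3 c4 c5 c6
  · subst c3; simp
  · obtain ⟨l, rfl⟩ := Nat.exists_eq_succ_of_ne_zero c3
    have h1 := Nat.one_le_two_pow (n := l)
    simp only [List.length_append, List.length_singleton, length_scale, length_piVec,
      Nat.succ_eq_add_one, length_sigma, pow_succ]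
    omega
  · rw [length_scale, length_rho]
  · obtain rfl := hw c4
    obtain _ | l := l
    · omega
    have h1 := Nat.one_le_two_pow (n := l)
    simp only [List.length_append, List.length_singleton, length_scale, length_w,
      length_sigma, pow_succ]
    omega
  · subst c6; simp
  · obtain ⟨l, rfl⟩ := Nat.exists_eq_succ_of_ne_zero c6
    have h1 := Nat.one_le_two_pow (n := l)
    have hd : (diff (scale ((1 + √2) ^ (2 * (l + 1))) (sigma (l + 1)))
        (scale (1 / 2) (piVec l))).length = 2 ^ l - 1 := by
      rw [length_diff] <;> simp
    simp only [List.length_append, List.length_singleton, length_scale,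
      Nat.succ_eq_add_one, Nat.add_sub_cancel, hd, length_w, pow_succ]
    omega
  · rw [length_scale, length_rho]

/-! ### The rows of the certificate -/

/-- The contribution of row `i` of the certificate to `L` times the quadratic form of `M`. -/
def rowForm (k : ℕ) (g P : ℕ → ℝ) (i : ℕ) : ℝ :=
  ldot (rowVec k i) fun q => cocoTerm g P i (i + q - 2 ^ nu (i + 1) / 2)

theorem two_pow_nu_le (n : ℕ) (hn : 0 < n) : 2 ^ nu n ≤ n := Nat.le_of_dvd hn pow_padicValNat_dvd

theorem add_two_pow_nu_le (n k : ℕ) (hn : 0 < n) (hk : n < 2 ^ k) : n + 2 ^ nu n ≤ 2 ^ k := by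
  have h1 := two_pow_nu_le n hn
  have h2 : nu n ≤ k := by
    rw [← Nat.pow_le_pow_iff_right (a := 2) (by norm_num)]; omega
  have h3 : 2 ^ nu n ∣ 2 ^ k - n := Nat.dvd_sub (pow_dvd_pow 2 h2) pow_padicValNat_dvd
  have h4 := Nat.le_of_dvd (by omega) h3
  omega

/-- The truncations in the definition of `entry` are harmless: the vector of the row fits into the
index range, and its diagonal entry is multiplied by `cocoTerm g P i i = 0`. -/
theorem sum_entry (k i : ℕ) (g P : ℕ → ℝ) (hk : 1 ≤ k) (hi : i + 1 < 2 ^ (k + 1)) :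
    ∑ j ∈ Finset.range (2 ^ (k + 1)), entry k i j * cocoTerm g P i j = rowForm k g P i := by
  have h1 := two_pow_nu_le (i + 1) (by omega)
  have h2 := add_two_pow_nu_le (i + 1) (k + 1) (by omega) hi
  have h3 := length_rowVec k i hk
  unfold rowForm
  obtain ⟨c, hc⟩ : ∃ c, i = c + 2 ^ nu (i + 1) / 2 := ⟨i - 2 ^ nu (i + 1) / 2, by omega⟩
  have hN : 2 ^ (k + 1) = c + (2 ^ (k + 1) - c) := by omega
  rw [hN, Finset.sum_range_add, Finset.sum_eq_zero, zero_add,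
    ← ldot_eq_sum _ _ (2 ^ (k + 1) - c) (by omega)]
  · refine Finset.sum_congr rfl fun q _ => ?_
    have e1 : i + q - 2 ^ nu (i + 1) / 2 = c + q := by omega
    have e2 : c + q + 2 ^ nu (i + 1) / 2 - i = q := by omega
    unfold entry
    rw [e1, e2]
    split_ifs with h
    · rcases h with h | h | h
      · omega
      · rw [← h]; simp [cocoTerm]
      · omega
    · rfl
  · intro j hj
    have hj := Finset.mem_range.1 hj
    unfold entry
    rw [if_pos (by omega), zero_mul]

/-- The rows of the first half that are not at a power of two. -/
theorem rowVec_left (r : ℕ) (hl : l < k) (hr : r < 2 ^ l - 1) :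
    rowVec k (2 ^ l + r) =
      scale ((mu (l + 1) - 1) / silver ^ (2 * l + 1) * silver ^ (2 * ones (r + 1)))
        (rho (nu (r + 1))) := by
  have h2 : 2 ^ (l + 1) ≤ 2 ^ k := Nat.pow_le_pow_right (by norm_num) hl
  rw [pow_succ] at h2
  have e : 2 ^ l + r + 1 = 2 ^ l * 1 + (r + 1) := by omega
  have hn : nu (2 ^ l + r + 1) = nu (r + 1) := by
    rw [e, nu_two_pow_mul_add l 1 (r + 1) (by omega) (by omega)]
  have hp : p (2 ^ l + r) = 1 + ones (r + 1) := by
    change ones (2 ^ l + r + 1) = _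
    rw [e, ones_two_pow_mul_add l 1 (r + 1) (by omega), ones_one]
  have hz : z (2 ^ l + r) = l :=
    Nat.log_eq_of_pow_le_of_lt_pow (by omega) (by rw [pow_succ]; omega)
  have h3 := two_pow_nu_le (r + 1) (by omega)
  have hc : (1 + √2 : ℝ) ^ (2 * ((l : ℤ) - ((1 + ones (r + 1) : ℕ) : ℤ)) + 3) =
      silver ^ (2 * l + 1) / silver ^ (2 * ones (r + 1)) := by
    rw [← zpow_natCast, ← zpow_natCast, ← zpow_sub₀ silver_ne_zero, silver]
    congr 1; push_cast; ring
  unfold rowVec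
  simp only [hn, hp, hz]
  rw [if_pos (by omega), if_neg (by omega), hc, div_div_eq_mul_div, div_mul_eq_mul_div]

/-- The rows of the second half at positions not mirrored to a power of two; the factor `s - 2` is
`s⁻¹`. -/
theorem rowVec_right (r : ℕ) (hl : l < k) (hr : r < 2 ^ l - 1) :
    rowVec k (2 ^ (k + 1) - 2 ^ (l + 1) + r) =
      scale ((silver - 2) / (mu (l + 1) - 1) * silver ^ (2 * ones (r + 1)))
        (rho (nu (r + 1))) := by
  have h2 : 2 ^ (l + 1) ≤ 2 ^ k := Nat.pow_le_pow_right (by norm_num) hl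
  have hk2 : 2 ^ (k + 1) = 2 ^ k * 2 := pow_succ _ _
  have hl2 : 2 ^ (l + 1) = 2 ^ l * 2 := pow_succ _ _
  have e : 2 ^ (k + 1) - 2 ^ (l + 1) + r + 1 = 2 ^ (l + 1) * (2 ^ (k - l) - 1) + (r + 1) := by
    rw [Nat.mul_sub, ← pow_add, mul_one]
    have : l + 1 + (k - l) = k + 1 := by omega
    rw [this, add_assoc]
  have hn : nu (2 ^ (k + 1) - 2 ^ (l + 1) + r + 1) = nu (r + 1) := by
    rw [e, nu_two_pow_mul_add _ _ (r + 1) (by omega) (by omega)]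
  have hp : p (2 ^ (k + 1) - 2 ^ (l + 1) + r) = (k - l) + ones (r + 1) := by
    change ones (2 ^ (k + 1) - 2 ^ (l + 1) + r + 1) = _
    rw [e, ones_two_pow_mul_add _ _ (r + 1) (by omega), ones_two_pow_sub_one]
  have hz : z (2 ^ (k + 1) - 2 - (2 ^ (k + 1) - 2 ^ (l + 1) + r)) = l :=
    Nat.log_eq_of_pow_le_of_lt_pow (by omega) (by omega)
  have h3 := two_pow_nu_le (r + 1) (by omega)
  have hc : (1 + √2 : ℝ) ^ (2 * (((k - l + ones (r + 1) : ℕ) : ℤ) + l - k) - 1) =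
      (silver - 2) * silver ^ (2 * ones (r + 1)) := by
    rw [mul_comm (silver - 2), ← silver_zpow_sub_one, silver]
    congr 1; push_cast [hl.le]; ring
  unfold rowVec
  simp only [hn, hp, hz]
  rw [if_neg (by omega), if_neg (by omega), if_neg (by omega), hc, div_mul_eq_mul_div]

theorem sum_rowForm_left (hl : l < k) :
    ∑ r ∈ Finset.range (2 ^ l - 1), rowForm k g P (2 ^ l + r) =
      (mu (l + 1) - 1) / silver ^ (2 * l + 1) *
      ∑ r ∈ Finset.range (2 ^ l - 1), silver ^ (2 * ones (r + 1)) *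
        ldot (rho (nu (r + 1)))
          (fun q => cocoTerm g P (2 ^ l + r) (2 ^ l + r + q - 2 ^ nu (r + 1) / 2)) := by
  rw [Finset.mul_sum]
  refine Finset.sum_congr rfl fun r hr => ?_
  have hr := Finset.mem_range.1 hr
  have hn : nu (2 ^ l + r + 1) = nu (r + 1) := by
    have := nu_two_pow_mul_add l 1 (r + 1) (by omega) (by omega)
    rwa [mul_one, ← add_assoc] at this
  rw [rowForm, rowVec_left r hl hr, ldot_scale, hn, mul_assoc]

theorem sum_rowForm_right (hl : l < k) :
    ∑ r ∈ Finset.range (2 ^ l - 1), rowForm k g P (2 ^ (k + 1) - 2 ^ (l + 1) + r) =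
      (silver - 2) / (mu (l + 1) - 1) *
      ∑ r ∈ Finset.range (2 ^ l - 1), silver ^ (2 * ones (r + 1)) *
        ldot (rho (nu (r + 1))) (fun q => cocoTerm g P (2 ^ (k + 1) - 2 ^ (l + 1) + r)
          (2 ^ (k + 1) - 2 ^ (l + 1) + r + q - 2 ^ nu (r + 1) / 2)) := by
  rw [Finset.mul_sum]
  refine Finset.sum_congr rfl fun r hr => ?_
  have hr := Finset.mem_range.1 hr
  have hn : nu (2 ^ (k + 1) - 2 ^ (l + 1) + r + 1) = nu (r + 1) := by
    have hl2 : 2 ^ (l + 1) = 2 ^ l * 2 := pow_succ _ _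
    have := nu_two_pow_mul_add (l + 1) (2 ^ (k - l) - 1) (r + 1) (by omega) (by omega)
    rw [Nat.mul_sub, ← pow_add, mul_one] at this
    have e : l + 1 + (k - l) = k + 1 := by omega
    rwa [e, ← add_assoc] at this
  rw [rowForm, rowVec_right r hl hr, ldot_scale, hn, mul_assoc]

/-- The contribution of the part left of the diagonal of row `2^l - 1`, for `l ≤ k`; at `l = 0` this
part has only the zero diagonal entry. -/
def leftPart (g P : ℕ → ℝ) : ℕ → ℝ
  | 0 => 0
  | l + 1 =>
    ((mu (l + 1) - 1) / (2 * silver ^ l) - 1) * cocoTerm g P (2 ^ (l + 1) - 1) (2 ^ l - 1) +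
      (mu (l + 1) - 1) * ldot (sigma (l + 1)) fun q => cocoTerm g P (2 ^ (l + 1) - 1) (2 ^ l + q)

theorem mu_one : mu 1 = 5 := by
  have h1 := (alpha_spec 0).1
  have h2 := alpha_quad 0
  have h3 := mu_succ 0
  rw [mu_zero] at h2 h3
  have h4 : (alpha 0 - 1 + 1) * (2 * (alpha 0 - 1) - 1) = 0 := by linear_combination h2
  have h5 : alpha 0 = 3 / 2 := by
    rcases mul_eq_zero.1 h4 with h | h <;> linarith
  rw [zero_add] at h3
  rw [h3, h5]; norm_num

/-- The rows `2^l - 1` with `l < k` and the row `2^k - 1` have the same left part, whatever the part `u`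
right of the diagonal is. -/
theorem ldot_leftPart (l : ℕ) (u : List ℝ) :
    ldot ([1 / 2 * (mu (l + 1) - 1) * (1 + √2) ^ (-(((l + 1 : ℕ) : ℤ) - 1)) - 1] ++
        scale (mu (l + 1) - 1) (sigma (l + 1)) ++ [0] ++ u)
      (fun q => cocoTerm g P (2 ^ (l + 1) - 1) (2 ^ (l + 1) - 1 + q - 2 ^ (l + 1) / 2)) =
    leftPart g P (l + 1) + ldot u fun q => cocoTerm g P (2 ^ (l + 1) - 1) (2 ^ (l + 1) + q) := by
  have h1 := Nat.one_le_two_pow (n := l)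
  have h2 : 2 ^ (l + 1) = 2 * 2 ^ l := by ring
  have hz : (1 + √2 : ℝ) ^ (-(((l + 1 : ℕ) : ℤ) - 1)) = (silver ^ l)⁻¹ := by
    rw [← zpow_natCast, ← zpow_neg, silver]; congr 1; push_cast; ring
  rw [ldot_append, ldot_append, ldot_append, ldot_scale, hz]
  simp only [List.length_append, List.length_singleton, length_scale, length_sigma,
    ldot_singleton, add_zero, zero_mul]
  have e1 : 2 ^ (l + 1) - 1 - 2 ^ (l + 1) / 2 = 2 ^ l - 1 := by omega
  have e2 : ∀ q, 2 ^ (l + 1) - 1 + (1 + q) - 2 ^ (l + 1) / 2 = 2 ^ l + q := by omega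
  have e3 : ∀ q, 2 ^ (l + 1) - 1 + (1 + (2 ^ l - 1) + 1 + q) - 2 ^ (l + 1) / 2 =
      2 ^ (l + 1) + q := by omega
  simp only [e1, e2, e3, leftPart]
  have := silver_ne_zero
  field_simp

theorem rowForm_two_pow (hl : l < k) :
    rowForm k g P (2 ^ l - 1) = leftPart g P l + (mu (l + 1) - 1) / (2 * silver ^ (2 * l)) *
      (ldot (piVec l) (fun q => cocoTerm g P (2 ^ l - 1) (2 ^ l + q)) +
        cocoTerm g P (2 ^ l - 1) (2 ^ l + (2 ^ l - 1))) := by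
  have h1 := Nat.one_le_two_pow (n := l)
  have h2 : 2 ^ l < 2 ^ k := Nat.pow_lt_pow_right (by norm_num) hl
  unfold rowForm rowVec
  simp only [Nat.sub_add_cancel h1, nu_two_pow]
  rw [if_pos h2, if_pos trivial]
  obtain _ | l := l
  · rw [if_pos rfl]
    simp [ldot, leftPart, piVec, mu_one]
    norm_num
  · rw [if_neg (by omega), List.append_assoc, ldot_leftPart, ldot_append, ldot_scale,
      length_scale, length_piVec, ldot_singleton, add_zero, silver]
    ring

theorem rowForm_mid (hk : 1 ≤ k) :
    rowForm k g P (2 ^ k - 1) = leftPart g P k +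
      1 / √(mu k - 1) * ldot (w k) fun q => cocoTerm g P (2 ^ k - 1) (2 ^ k + q) := by
  have h1 := Nat.one_le_two_pow (n := k)
  unfold rowForm rowVec
  simp only [Nat.sub_add_cancel h1, nu_two_pow]
  rw [if_neg (lt_irrefl _), if_pos trivial]
  obtain _ | k := k
  · omega
  · rw [ldot_leftPart, ldot_scale]

/-- The row at the midpoint `2^(k+1) - 2^l - 1` of the last `2^(l+1)` positions. Its left part is a
multiple of that of `ρ_l`, written as in `ldot_rho`; the factor `s - 2` is `s⁻¹`. -/
theorem rowForm_tail (hl : l < k) :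
    rowForm k g P (2 ^ (k + 1) - 2 ^ (l + 1) + (2 ^ l - 1)) =
      (silver - 2) / (mu (l + 1) - 1) *
        (leftDot l (fun q => cocoTerm g P (2 ^ (k + 1) - 2 ^ (l + 1) + (2 ^ l - 1))
            (2 ^ (k + 1) - 2 ^ (l + 1) + q)) -
          ldot (piVec l) (fun q => cocoTerm g P (2 ^ (k + 1) - 2 ^ (l + 1) + (2 ^ l - 1))
            (2 ^ (k + 1) - 2 ^ (l + 1) + q))) +
      (1 / √(mu l - 1) - 1 / √(mu (l + 1) - 1)) *
        ldot (w l) (fun q => cocoTerm g P (2 ^ (k + 1) - 2 ^ (l + 1) + (2 ^ l - 1))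
          (2 ^ (k + 1) - 2 ^ l + q)) := by
  have h1 := Nat.one_le_two_pow (n := l)
  have h2 : 2 ^ (l + 1) ≤ 2 ^ k := Nat.pow_le_pow_right (by norm_num) hl
  have hk2 : 2 ^ (k + 1) = 2 ^ k * 2 := pow_succ _ _
  have hl2 : 2 ^ (l + 1) = 2 ^ l * 2 := pow_succ _ _
  generalize hb : 2 ^ (k + 1) - 2 ^ (l + 1) = b
  have e0 : b + (2 ^ l - 1) + 1 = 2 ^ l * (2 ^ (k + 1 - l) - 1) := by
    rw [Nat.mul_sub, ← pow_add, mul_one]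
    have : l + (k + 1 - l) = k + 1 := by omega
    rw [this]; omega
  have hn : nu (b + (2 ^ l - 1) + 1) = l := by
    have hodd : ¬ 2 ∣ 2 ^ (k + 1 - l) - 1 := by
      obtain ⟨c, hc⟩ : ∃ c, k + 1 - l = c + 1 := ⟨k - l, by omega⟩
      have := Nat.one_le_two_pow (n := c)
      rw [hc, pow_succ]; omega
    have hne : 2 ^ (k + 1 - l) - 1 ≠ 0 := fun h => hodd (by rw [h]; simp)
    rw [e0, nu, padicValNat.mul (by positivity) hne, padicValNat.prime_pow,
      padicValNat.eq_zero_of_not_dvd hodd, add_zero]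
  have e1 : 2 ^ (k + 1) - 2 ^ l = b + 2 ^ l := by omega
  unfold rowForm rowVec
  simp only [hn]
  rw [if_neg (by omega), if_neg (by omega), if_pos (by omega), e1]
  generalize hF : cocoTerm g P (b + (2 ^ l - 1)) = F
  obtain _ | l := l
  · rw [if_pos rfl]
    simp [ldot, leftDot_zero, piVec, w, mu_zero, mu_one]
    norm_num
  · have h3 := Nat.one_le_two_pow (n := l)
    have h4 : 2 ^ (l + 1) = 2 ^ l * 2 := pow_succ _ _
    have hd : (diff (scale ((1 + √2) ^ (2 * (l + 1))) (sigma (l + 1)))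
        (scale (1 / 2) (piVec l))).length = 2 ^ l - 1 := by
      rw [length_diff] <;> simp
    have hz : (1 + √2 : ℝ) ^ (((l + 1 : ℕ) : ℤ) - 1) = silver ^ l := by
      rw [← zpow_natCast, silver]; congr 1; push_cast; ring
    rw [if_neg (by omega), ldot_append, ldot_append, ldot_append, leftDot_succ]
    simp only [List.length_append, List.length_singleton, length_scale, Nat.add_sub_cancel, hd,
      ldot_singleton, zero_mul, add_zero, ldot_scale]
    rw [ldot_diff _ _ _ (by simp), ldot_scale, ldot_scale, hz, leftDot]
    have i1 : b + (2 ^ (l + 1) - 1) - 2 ^ (l + 1) / 2 = b + (2 ^ l - 1) := by omega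
    have i2 : ∀ q, b + (2 ^ (l + 1) - 1) + (1 + q) - 2 ^ (l + 1) / 2 = b + (2 ^ l + q) := by
      omega
    have i3 : ∀ q, b + (2 ^ (l + 1) - 1) + (1 + (2 ^ l - 1) + 1 + q) - 2 ^ (l + 1) / 2 =
        b + 2 ^ (l + 1) + q := by omega
    simp only [i1, i2, i3]
    have hs : silver * (silver - 2) = 1 := by linear_combination silver_sq
    change _ + 1 / _ * (silver ^ (2 * (l + 1)) * _ - _) + _ = _
    generalize ldot (sigma (l + 1)) (fun q => F (b + (2 ^ l + q))) = A
    generalize ldot (piVec l) (fun q => F (b + (2 ^ l + q))) = B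
    generalize F (b + (2 ^ l - 1)) = D
    have hm : mu (l + 1 + 1) - 1 ≠ 0 := by linarith [mu_gt_one (l + 1 + 1)]
    have hp1 : silver ^ (l + 1) * (silver - 2) = silver ^ l := by
      linear_combination silver ^ l * hs
    have hp2 : silver ^ 2 * silver ^ (2 * l + 1) * (silver - 2) = silver ^ (2 * (l + 1)) := by
      linear_combination silver ^ (2 * (l + 1)) * hs
    rw [← hp1, ← hp2]
    field_simp
    linear_combination B * (silver * (silver - 2) + 1) * hs

/-! ### Summing the rows -/

/-- The rows before `2^l - 1`, with the left part of row `2^l - 1`, only leave a multiple of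
`g_(2^l - 1)²`. -/
theorem PatternSteps.left_half (h : PatternSteps k g P) (hl : l ≤ k) :
    ∑ i ∈ Finset.range (2 ^ l - 1), rowForm k g P i + leftPart g P l =
      (mu l - 2) / 2 * g (2 ^ l - 1) ^ 2 := by
  induction l with
  | zero => simp [leftPart, mu_zero]
  | succ l ih =>
    have hlk : l < k := hl
    have ih := ih hlk.le
    have h1 := Nat.one_le_two_pow (n := l)
    have h2 : 2 ^ (l + 1) = 2 * 2 ^ l := by ring
    have e : 2 ^ (l + 1) - 1 = (2 ^ l - 1) + 1 + (2 ^ l - 1) := by omega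
    have e0 : 2 ^ l - 1 + 1 = 2 ^ l := by omega
    have hB := h.left_block hlk
    have key := hB.block_eq
    have p1 := hB.total
    have p2 := h.left_alpha hlk
    rw [leftPart, e, Finset.sum_range_add, Finset.sum_range_succ, e0, sum_rowForm_left hlk,
      rowForm_two_pow hlk]
    have ht : 0 < silver ^ l := pow_pos silver_pos l
    have hu : silver ^ (2 * l + 1) = silver * (silver ^ l) ^ 2 := by ring
    have hu2 : silver ^ (2 * l) = (silver ^ l) ^ 2 := by ring
    have hm1 := mu_succ_mul l
    have hm2 := mu_succ l
    -- `C` is the common factor of the rows of the block, in terms of which the other factors are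
    -- polynomials
    obtain ⟨C, hC⟩ : ∃ C, mu (l + 1) - 1 = C * (silver * (silver ^ l) ^ 2) :=
      ⟨(mu (l + 1) - 1) / (silver * (silver ^ l) ^ 2), by
        have := silver_ne_zero
        field_simp⟩
    have hC1 : (mu (l + 1) - 1) / silver ^ (2 * l + 1) = C := by
      rw [hC, hu]; have := silver_ne_zero; field_simp
    have hC2 : (mu (l + 1) - 1) / (2 * silver ^ (2 * l)) = C * silver / 2 := by
      rw [hC, hu2]; field_simp
    have hC3 : (mu (l + 1) - 1) / (2 * silver ^ l) = C * silver * silver ^ l / 2 := by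
      rw [hC]; field_simp
    have hC4 : C * silver * (silver ^ l - (alpha l - 1)) = 2 := by
      rw [hC, hu2] at hm1
      refine mul_left_cancel₀ (pow_ne_zero 2 ht.ne') ?_
      linear_combination hm1
    have hsig : ∀ f, (mu (l + 1) - 1) * ldot (sigma (l + 1)) f =
        C * (leftDot l f + (silver - 2) / 2 * ldot (piVec l) f) := fun f => by
      rw [leftDot, hC, hu]; ring
    rw [hsig, hC1, hC2, hC3]
    rw [ldot_cocoTerm, ldot_cocoTerm, ldot_piVec_one]
    generalize leftDot l (fun q => cocoTerm g P (2 ^ l + (2 ^ l - 1)) (2 ^ l + q)) = K at *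
    generalize (∑ r ∈ Finset.range (2 ^ l - 1), silver ^ (2 * ones (r + 1)) *
        ldot (rho (nu (r + 1)))
          (fun q => cocoTerm g P (2 ^ l + r) (2 ^ l + r + q - 2 ^ nu (r + 1) / 2))) = T at *
    unfold cocoTerm
    rw [p1, p2]
    generalize linSum g (piVec l) (2 ^ l) = S at *
    generalize quadSum g P (piVec l) (2 ^ l) = J at *
    generalize g (2 ^ l - 1) = x at *
    generalize g (2 ^ l + (2 ^ l - 1)) = y at *
    rw [hu] at key
    generalize silver ^ l = t at *
    have hmu : mu (l + 1) = C * (silver * t ^ 2) + 1 := by linear_combination hC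
    have hmu0 : mu l = C * (silver * t ^ 2) + 1 - 2 * alpha l - 2 * t + 2 := by
      linear_combination hC - hm2
    rw [hmu0] at ih
    rw [hmu]
    -- the cancellation of the remaining cross terms is the relation `hC4` between `C` and `α_l`
    linear_combination ih + C * key + (x ^ 2 * t / 2 - x * S / 2 - x * y / 2) * hC4

/-- The last `2^l - 1` nonzero rows, together with the terms that a preceding row with right part
`w_l / √(μ_l - 1)` contributes at the last `2^l` positions alone, form the perfect square
`(w_l · g)² / 2`. -/
theorem PatternSteps.right_half (h : PatternSteps k g P) (hl : l ≤ k) :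
    ∑ r ∈ Finset.range (2 ^ l - 1), rowForm k g P (2 ^ (k + 1) - 2 ^ l + r) +
      1 / √(mu l - 1) * quadSum g P (w l) (2 ^ (k + 1) - 2 ^ l) =
      linSum g (w l) (2 ^ (k + 1) - 2 ^ l) ^ 2 / 2 := by
  induction l with
  | zero => simp [quadSum, linSum, w, mu_zero]; norm_num
  | succ l ih =>
    have hlk : l < k := hl
    have ih := ih hlk.le
    have h1 := Nat.one_le_two_pow (n := l)
    have h2 : 2 ^ (l + 1) = 2 * 2 ^ l := by ring
    have h3 : 2 ^ (l + 1) ≤ 2 ^ (k + 1) := Nat.pow_le_pow_right (by norm_num) (by omega)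
    have e : 2 ^ (l + 1) - 1 = (2 ^ l - 1) + 1 + (2 ^ l - 1) := by omega
    have eb : ∀ r, 2 ^ (k + 1) - 2 ^ (l + 1) + (2 ^ l - 1 + 1 + r) = 2 ^ (k + 1) - 2 ^ l + r := by
      omega
    have hB := h.right_block hlk
    have key := hB.block_eq
    have p1 := hB.total
    have p2 := h.right_alpha hlk
    rw [e, Finset.sum_range_add, Finset.sum_range_succ, sum_rowForm_right hlk, rowForm_tail hlk]
    simp only [eb]
    have e1 : 2 ^ (k + 1) - 2 ^ (l + 1) + (piVec l).length =
        2 ^ (k + 1) - 2 ^ (l + 1) + (2 ^ l - 1) := by rw [length_piVec]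
    have e2 : 2 ^ (k + 1) - 2 ^ (l + 1) +
        (scale (1 / √(mu (l + 1) - 1)) (piVec l) ++
          [beta (l + 1) / √(mu (l + 1) - 1)]).length = 2 ^ (k + 1) - 2 ^ l := by
      simp; omega
    rw [w, quadSum_append, quadSum_append, linSum_append, linSum_append, e2, length_scale, e1,
      ldot_cocoTerm, ldot_cocoTerm, ldot_piVec_one, ldot_w_one]
    have q1 : ∀ c b, linSum g (scale c (piVec l)) b = c * linSum g (piVec l) b :=
      fun c b => ldot_scale _ _ _
    have q2 : ∀ c b, quadSum g P (scale c (piVec l)) b = c * quadSum g P (piVec l) b :=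
      fun c b => ldot_scale _ _ _
    have q3 : ∀ c b, linSum g [c] b = c * g b := fun c b => by simp [linSum]
    have q4 : ∀ c b, quadSum g P [c] b = c * (g b ^ 2 / 2) := fun c b => by simp [quadSum]
    rw [q1, q2, q3, q4, p2, p1, beta_succ]
    generalize leftDot l _ = K at *
    generalize (∑ r ∈ Finset.range (2 ^ l - 1), silver ^ (2 * ones (r + 1)) * _) = T at *
    generalize (∑ r ∈ Finset.range (2 ^ l - 1), rowForm k g P (2 ^ (k + 1) - 2 ^ l + r)) = Z at *
    have ha := alpha_mul_sqrt_mu_succ l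
    have hd := sqrt_mu_succ_sub l
    have hM := sq_sqrt_mu (l + 1)
    have hM0 := sqrt_mu_pos (l + 1)
    have hm0 := sqrt_mu_pos l
    have hs := silver_sq
    have hu : silver ^ (2 * l + 1) = silver * (silver ^ l) ^ 2 := by ring
    rw [hu] at key
    generalize √(mu (l + 1) - 1) = M at *
    generalize √(mu l - 1) = m at *
    rw [← hM]
    generalize linSum g (piVec l) _ = S at *
    generalize quadSum g P (piVec l) _ = J at *
    generalize linSum g (w l) _ = W at *
    generalize quadSum g P (w l) _ = V at *
    generalize g (2 ^ (k + 1) - 2 ^ (l + 1) + (2 ^ l - 1)) = x at *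
    generalize silver ^ l = t at *
    have hT := eq_sub_of_add_eq key
    have hZ := eq_sub_of_add_eq ih
    rw [hT, hZ]
    have hi := inv_mul_cancel₀ hM0.ne'
    have hn := inv_mul_cancel₀ hm0.ne'
    simp only [div_eq_mul_inv, one_mul, ← inv_pow]
    generalize M⁻¹ = i at *
    generalize m⁻¹ = n at *
    -- `hd` settles the coefficient of `x²` and `ha` that of `x * W`
    linear_combination i ^ 2 * (S ^ 2 / 2 - J + (t ^ 2 - t) / 2 * x ^ 2) * hs +
      x ^ 2 / 2 * (hn - (1 + i * M - i * m) * hi + i ^ 2 * hd) +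
      x * W * (n * i * ha - n * (alpha l - 1) * hi + t * i * hn)

/-- The quadratic form of `L M` is `(φ · g)² / 2`. -/
theorem PatternSteps.total (h : PatternSteps k g P) (hk : 1 ≤ k) :
    ∑ i ∈ Finset.range (2 ^ (k + 1) - 1), rowForm k g P i =
      (√(mu k - 1) * g (2 ^ k - 1) + linSum g (w k) (2 ^ k)) ^ 2 / 2 := by
  have h1 := Nat.one_le_two_pow (n := k)
  have h2 : 2 ^ (k + 1) = 2 * 2 ^ k := by ring
  have e : 2 ^ (k + 1) - 1 = (2 ^ k - 1) + 1 + (2 ^ k - 1) := by omega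
  have e0 : 2 ^ k - 1 + 1 = 2 ^ k := by omega
  have e1 : 2 ^ (k + 1) - 2 ^ k = 2 ^ k := by omega
  have hl := h.left_half le_rfl
  have hr := h.right_half le_rfl
  have hm := sq_sqrt_mu k
  have hm0 := sqrt_mu_pos k
  rw [e1] at hr
  rw [e, Finset.sum_range_add, Finset.sum_range_succ, e0, rowForm_mid hk, ldot_cocoTerm,
    ldot_w_one, h.mid]
  have hmu : mu k = √(mu k - 1) ^ 2 + 1 := by linear_combination -hm
  generalize √(mu k - 1) = m at *
  rw [hmu] at hl ⊢
  have hl' := eq_sub_of_add_eq hl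
  have hr' := eq_sub_of_add_eq hr
  rw [hl', hr']
  field_simp
  ring

/-! ### From quadratic forms to matrices -/

/-- Two real symmetric matrices with the same quadratic form are equal. -/
theorem ext_of_dotProduct {n : ℕ} {A B : Matrix (Fin n) (Fin n) ℝ} (hA : A.IsSymm) (hB : B.IsSymm)
    (h : ∀ v, v ⬝ᵥ A.mulVec v = v ⬝ᵥ B.mulVec v) : A = B := by
  have hd : ∀ a, A a a = B a a := fun a => by simpa using h (Pi.single a 1)
  ext a b
  have h1 := h (Pi.single a 1 + Pi.single b 1)
  simp only [Matrix.mulVec_add, dotProduct_add, add_dotProduct, Matrix.mulVec_single_one,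
    single_one_dotProduct, Matrix.col_apply, hd] at h1
  have h2 := hA.apply a b
  have h3 := hB.apply a b
  linarith

theorem symOuter_isSymm {n : ℕ} (x y : Fin n → ℝ) : (symOuter x y).IsSymm := by
  ext a b
  simp [symOuter, Matrix.vecMulVec_apply]
  ring

theorem symOuter_form {n : ℕ} (x y v : Fin n → ℝ) :
    v ⬝ᵥ (symOuter x y).mulVec v = (x ⬝ᵥ v) * (y ⬝ᵥ v) := by
  simp only [symOuter, Matrix.smul_mulVec, Matrix.add_mulVec, Matrix.vecMulVec_mulVec,
    dotProduct_smul, dotProduct_add, smul_eq_mul, op_smul_eq_smul]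
  rw [dotProduct_comm v x, dotProduct_comm v y]
  ring

theorem matM_isSymm (t : ℕ) (L : ℝ) (lam : Matrix (Option (Fin (t + 1))) (Option (Fin (t + 1))) ℝ)
    (h : Fin t → ℝ) : (matM t L lam h).IsSymm := by
  have hs : ∀ i j, (if i ≠ j then lam i j • (matA t L h i j + (1 / (2 * L)) • matC t i j)
      else 0).IsSymm := by
    intro i j
    split_ifs
    · exact ((symOuter_isSymm _ _).add ((symOuter_isSymm _ _).smul _)).smul _
    · exact Matrix.isSymm_zero
  ext a b
  simp only [Matrix.transpose_apply, matM, matZ, Matrix.submatrix_apply, zero_smul, zero_add,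
    Matrix.sum_apply]
  exact Finset.sum_congr rfl fun i _ => Finset.sum_congr rfl fun j _ => (hs i j).apply _ _

theorem submatrix_succ_form {t : ℕ} (A : Matrix (Fin (t + 2)) (Fin (t + 2)) ℝ)
    (v : Fin (t + 1) → ℝ) :
    v ⬝ᵥ (A.submatrix Fin.succ Fin.succ).mulVec v =
      (Fin.cons 0 v : Fin (t + 2) → ℝ) ⬝ᵥ A.mulVec (Fin.cons 0 v) := by
  simp [dotProduct, Matrix.mulVec, Fin.sum_univ_succ (n := t + 1)]

theorem gVec_dotProduct (t : ℕ) (i : Fin (t + 1)) (v : Fin (t + 1) → ℝ) :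
    gVec t (some i) ⬝ᵥ (Fin.cons 0 v : Fin (t + 2) → ℝ) = v i := by
  simp [gVec]

theorem xVec_dotProduct (t : ℕ) (L : ℝ) (h : Fin t → ℝ) (i : Fin (t + 1)) (v : Fin (t + 1) → ℝ) :
    xVec t L h (some i) ⬝ᵥ (Fin.cons 0 v : Fin (t + 2) → ℝ) =
      -(1 / L) * ∑ j : Fin t, if j.1 < i.1 then h j * v j.castSucc else 0 := by
  simp only [xVec, sub_dotProduct, smul_dotProduct, sum_dotProduct]
  rw [single_one_dotProduct, Fin.cons_zero, zero_sub, smul_eq_mul, neg_mul]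
  congr 2
  refine Finset.sum_congr rfl fun j _ => ?_
  split_ifs
  · rw [smul_dotProduct, gVec_dotProduct, smul_eq_mul]
  · simp

/-- The quadratic form of `M` in terms of partial sums `P` of the steps, for multipliers that vanish in
row and column `⋆`. -/
theorem matM_form (t : ℕ) (L : ℝ) (hL : L ≠ 0)
    (lam : Matrix (Option (Fin (t + 1))) (Option (Fin (t + 1))) ℝ)
    (h1 : ∀ j, lam none j = 0) (h2 : ∀ i, lam i none = 0) (h : Fin t → ℝ) (g P : ℕ → ℝ)
    (h0 : P 0 = 0) (hP : ∀ j : Fin t, P (j + 1) = P j + h j * g j) :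
    (fun i : Fin (t + 1) => g i) ⬝ᵥ (matM t L lam h).mulVec (fun i : Fin (t + 1) => g i) =
      1 / L * ∑ i : Fin (t + 1), ∑ j : Fin (t + 1), lam (some i) (some j) * cocoTerm g P i j := by
  -- the truncated sums that define the `𝐱_i` are the partial sums `P`
  have hX : ∀ n, n ≤ t → ∑ j : Fin t, (if j.1 < n then h j * g j else 0) = P n := by
    intro n hn
    induction n with
    | zero => simp [h0]
    | succ n ih =>
      rw [hP ⟨n, hn⟩, ← ih (by omega)]
      have : ∀ j : Fin t, (if j.1 < n + 1 then h j * g j else 0) =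
          (if j.1 < n then h j * g j else 0) + if j = ⟨n, hn⟩ then h j * g j else 0 := by
        intro j
        simp only [Fin.ext_iff]
        split_ifs <;> first | omega | simp
      rw [Finset.sum_congr rfl fun j _ => this j, Finset.sum_add_distrib, Finset.sum_ite_eq']
      simp
  have hterm : ∀ i j : Fin (t + 1),
      (Fin.cons 0 (fun i : Fin (t + 1) => g i) : Fin (t + 2) → ℝ) ⬝ᵥ
        (if some i ≠ some j then lam (some i) (some j) •
          (matA t L h (some i) (some j) + (1 / (2 * L)) • matC t (some i) (some j))
          else 0).mulVec (Fin.cons 0 (fun i : Fin (t + 1) => g i)) =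
      1 / L * (lam (some i) (some j) * cocoTerm g P i j) := by
    intro i j
    split_ifs with hij
    · simp only [Matrix.smul_mulVec, Matrix.add_mulVec, dotProduct_smul, dotProduct_add, matA,
        matC, symOuter_form, sub_dotProduct, gVec_dotProduct, xVec_dotProduct, smul_eq_mul]
      have e : ∀ i : Fin (t + 1), ∑ j : Fin t,
          (if j.1 < i.1 then h j * g (j.castSucc : Fin (t + 1)) else 0) = P i :=
        fun i => hX i (by omega)
      rw [e, e, cocoTerm]
      field_simp
      ring
    · have : i = j := by simpa using hij
      simp [this, cocoTerm]
  rw [matM, submatrix_succ_form, matZ, zero_smul, zero_add]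
  simp only [Fintype.sum_option, h1, h2, zero_smul, ite_self, Finset.sum_const_zero, zero_add,
    Matrix.sum_mulVec, dotProduct_sum, hterm, Finset.mul_sum]

theorem certificate_eq (k : ℕ) (hk : 1 ≤ k) (L : ℝ) (hL : 0 < L) :
    matM (2 ^ (k + 1) - 1) L (certificate k) (pattern k) =
      (1 / (2 * L)) • Matrix.vecMulVec (phi k) (phi k) := by
  have h1 := Nat.one_le_two_pow (n := k)
  have h2 : 2 ^ (k + 1) = 2 * 2 ^ k := by ring
  have hsym : ((1 / (2 * L)) • Matrix.vecMulVec (phi k) (phi k)).IsSymm := by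
    ext a b; simp [Matrix.vecMulVec_apply, mul_comm]
  refine ext_of_dotProduct (matM_isSymm _ _ _ _) hsym fun v => ?_
  obtain ⟨g, rfl⟩ : ∃ g : ℕ → ℝ, v = fun i => g i.1 :=
    ⟨fun n => if hn : n < 2 ^ (k + 1) - 1 + 1 then v ⟨n, hn⟩ else 0, by
      ext i
      change v i = if hn : i.1 < 2 ^ (k + 1) - 1 + 1 then v ⟨i.1, hn⟩ else 0
      rw [dif_pos i.2]⟩
  let P : ℕ → ℝ := fun n => ∑ j ∈ Finset.range n, (patternList k).getD j 0 * g j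
  have hP : PatternSteps k g P := fun j => Finset.sum_range_succ _ _
  rw [matM_form _ L hL.ne' (certificate k) (fun j => rfl) (fun i => by cases i <;> rfl)
    (pattern k) g P (by simp [P]) (fun j => hP j)]
  have hrows : ∑ i : Fin (2 ^ (k + 1) - 1 + 1), ∑ j : Fin (2 ^ (k + 1) - 1 + 1),
      certificate k (some i) (some j) * cocoTerm g P i j =
      ∑ i ∈ Finset.range (2 ^ (k + 1) - 1), rowForm k g P i := by
    have e : 2 ^ (k + 1) - 1 + 1 = 2 ^ (k + 1) := by omega
    have hF : ∑ i : Fin (2 ^ (k + 1) - 1 + 1), ∑ j : Fin (2 ^ (k + 1) - 1 + 1),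
        certificate k (some i) (some j) * cocoTerm g P i j =
        ∑ i ∈ Finset.range (2 ^ (k + 1) - 1 + 1), ∑ j ∈ Finset.range (2 ^ (k + 1) - 1 + 1),
          entry k i j * cocoTerm g P i j := by
      simp only [Finset.sum_range, certificate]
    rw [hF, Finset.sum_range_succ, e]
    rw [Finset.sum_eq_zero (s := Finset.range (2 ^ (k + 1))), add_zero]
    · refine Finset.sum_congr rfl fun i hi => ?_
      have hi := Finset.mem_range.1 hi
      exact sum_entry k i g P hk (by omega)
    · intro j _
      simp [entry]
  have hphi : phi k ⬝ᵥ (fun i => g i.1) = √(mu k - 1) * g (2 ^ k - 1) + linSum g (w k) (2 ^ k) := by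
    have := ldot_eq_sum (List.replicate (2 ^ k - 1) 0 ++ [√(mu k - 1)] ++ w k) g
      (2 ^ (k + 1) - 1 + 1) (by simp; omega)
    rw [Finset.sum_range] at this
    change ∑ i, phi k i * g i = _
    have hz : ∀ (n : ℕ) (f : ℕ → ℝ), ldot (List.replicate n 0) f = 0 := by
      intro n
      induction n with
      | zero => simp
      | succ n ih => intro f; simp [List.replicate_succ, ldot, ih]
    have e : 2 ^ k - 1 + 1 = 2 ^ k := by omega
    unfold phi
    rw [this, ldot_append, ldot_append, hz]
    simp [e, linSum]
  rw [hrows, hP.total hk, ← hphi, Matrix.smul_mulVec, dotProduct_smul, Matrix.vecMulVec_mulVec]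
  simp only [dotProduct_smul, smul_eq_mul, op_smul_eq_smul]
  rw [dotProduct_comm _ (phi k)]
  field_simp

theorem w_nonneg (l : ℕ) : ∀ x ∈ w l, 0 ≤ x := by
  induction l with
  | zero => simp [w]
  | succ l ih =>
    intro x hx
    simp only [w, scale, piVec, List.mem_append, List.mem_map, List.mem_singleton] at hx
    rcases hx with (⟨y, ⟨i, _, rfl⟩, rfl⟩ | rfl) | hx
    · have := beta_gt_one (nu (i + 1)); positivity
    · have := beta_gt_one (l + 1); positivity
    · exact ih x hx

theorem phi_nonneg (k : ℕ) (i : Fin (2 ^ (k + 1) - 1 + 1)) : 0 ≤ phi k i := by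
  unfold phi
  rw [List.getD_eq_getElem?_getD]
  cases hx : (List.replicate (2 ^ k - 1) 0 ++ [√(mu k - 1)] ++ w k)[i.1]? with
  | none => simp
  | some x =>
    have hx := List.mem_of_getElem? hx
    simp only [List.mem_append, List.mem_replicate, List.mem_singleton] at hx
    rcases hx with (⟨_, rfl⟩ | rfl) | hx
    · simp
    · exact Real.sqrt_nonneg _
    · exact w_nonneg k x hx

theorem phi_ne_zero (k : ℕ) : phi k ≠ 0 := by
  have h1 := Nat.one_le_two_pow (n := k)
  have h2 : 2 ^ (k + 1) = 2 * 2 ^ k := by ring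
  intro h
  have h3 := congrFun h ⟨2 ^ k - 1, by omega⟩
  simp [phi] at h3
  exact (sqrt_mu_pos k).ne' h3

end

end LongSteps

theorem mainTheorem5 (k : ℕ) (hk : 1 ≤ k) (L : ℝ) (hL : 0 < L) :
    LongSteps.matM (2 ^ (k + 1) - 1) L (LongSteps.certificate k) (LongSteps.pattern k) =
        (1 / (2 * L)) • Matrix.vecMulVec (LongSteps.phi k) (LongSteps.phi k) ∧
      (∀ i j, 0 ≤ LongSteps.matM (2 ^ (k + 1) - 1) L (LongSteps.certificate k)
        (LongSteps.pattern k) i j) ∧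
      (LongSteps.matM (2 ^ (k + 1) - 1) L (LongSteps.certificate k)
        (LongSteps.pattern k)).rank = 1 := by
  have h := LongSteps.certificate_eq k hk L hL
  have hφ := LongSteps.phi_ne_zero k
  refine ⟨h, fun i j => ?_, ?_⟩
  · rw [h, Matrix.smul_apply, Matrix.vecMulVec_apply]
    have := LongSteps.phi_nonneg k i
    have := LongSteps.phi_nonneg k j
    simp only [smul_eq_mul]
    positivity
  · rw [h, ← Matrix.smul_vecMulVec]
    refine le_antisymm (Matrix.rank_vecMulVec_le _ _) (Nat.one_le_iff_ne_zero.2 fun h0 => ?_)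
    obtain ⟨i, hi⟩ := Function.ne_iff.1 hφ
    have h1 := LinearMap.range_eq_bot.1 (Submodule.finrank_eq_zero.1 h0)
    have h1 := congrFun (LinearMap.congr_fun h1 (Pi.single i 1)) i
    simp only [Matrix.mulVecLin_apply, Matrix.mulVec_single_one, Matrix.col_apply,
      Matrix.vecMulVec_apply, Pi.smul_apply, smul_eq_mul, LinearMap.zero_apply,
      Pi.zero_apply] at h1
    simp only [Pi.zero_apply] at hi
    simp [hi, hL.ne'] at h1
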